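/- Let $\mathbb F_q$ be a finite field with $q$ elements, $A=\mathbb F_q[\theta]$, $K_\infty=\mathbb F_q((1/\theta))$ with the absolute value $|\alpha|_\infty=q^{-v_\infty(\alpha)}$ normalised by $|\theta|_\infty=q$, and let $\mathbb C_\infty$ be the completion of an algebraic closure of $K_\infty$, with the extended absolute value. For an $\mathbb F_q$- and $K_\infty$-algebra $R$ (compatibly), let $a\mapsto C_a\in\mathrm{End}_{\mathbb F_q}(R)$ be the $\mathbb F_q$-algebra morphism on $A$ with $C_\theta(x)=\theta x+x^q$ (the Carlitz module). Let $\Lambda_C=\{x\in\mathbb C_\infty : C_a(x)=0\text{ for some }a\in A\setminus\{0\}\}$ and let $\mathfrak K$ be the closure of $\Lambda_C$ in $\mathbb C_\infty$. Let $$\tilde\pi=\sqrt[q-1]{\theta-\theta^q}\,\prod_{i\ge1}\Bigl(1-\frac{\theta^{q^i}-\theta}{\theta^{q^{i+1}}-\theta}\Bigr)\in\mathbb C_\infty$$ (for any choice of the root), $L=K_\infty(\tilde\pi)$ and $\pi=\theta/\tilde\pi$. For an integer $N\ge0$ with base-$q$ expansion $N=\sum_i N_iq^i$ put $l_q(N)=\sum_i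 N_i$, $$H_N(X)=\prod_i C_{\theta^i}(X)^{N_i}\in K_\infty[X],\qquad G_N(X)=\pi^{l_q(N)}H_N(X)\in L[X].$$ Let $s\ge1$. For a field $K_\infty\subseteq E\subseteq\mathbb C_\infty$ complete with respect to $|\cdot|_\infty$, let $\mathbb B_s(E)$ be the completion of $E[X_1,\dots,X_s]$ for the norm $\|F\|=\sup\{|F(x)|_\infty : x\in\mathfrak K^s\}$. 1. If $L\subseteq E$, the family $G_{N_1}(X_1)\cdots G_{N_s}(X_s)$, $(N_1,\dots,N_s)\in\mathbb N^s$, is an orthonormal basis of the $E$-Banach space $\mathbb B_s(E)$: every $F\in\mathbb B_s(E)$ can be written in a unique way as the sum of a summable family $$F=\sum_{N\in\mathbb N^s}f_{N}\,G_{N_1}(X_1)\cdots G_{N_s}(X_s),\qquad f_N\in E;$$ moreover $f_N\to0$ along the Fréchet (cofinite) filter of $\mathbb N^s$, and $\|F\|=\max_N|f_N|_\infty$ (the maximum is attained). 2. For every complete $E$ with $K_\infty\subseteq E\subseteq\mathbb C_\infty$, the family $H_{N_1}(X_1)\cdots H_{N_s}(X_s)$, $(N_1,\dots,N_s)\in\mathbb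 N^s$, is an orthogonal basis of $\mathbb B_s(E)$: every $F\in\mathbb B_s(E)$ can be written in a unique way as the sum of a summable family $$F=\sum_{N\in\mathbb N^s}f_{N}\,H_{N_1}(X_1)\cdots H_{N_s}(X_s),\qquad f_N\in E;$$ moreover $|f_N|_\infty\,q^{(l_q(N_1)+\cdots+l_q(N_s))/(q-1)}\to0$ along the Fréchet filter, and $$\|F\|=\max_N\|f_N H_{N_1}(X_1)\cdots H_{N_s}(X_s)\|=\max_N|f_N|_\infty\,q^{(l_q(N_1)+\cdots+l_q(N_s))/(q-1)}.$$ -/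

import Mathlib

open Filter Topology

set_option linter.unusedSectionVars false

noncomputable section

namespace Carlitz

/-! ### The fields `K_∞ = 𝔽_q((1/θ))` and `ℂ_∞` -/

variable (F : Type*) [Field F] [Fintype F]

/-- `K_∞ = 𝔽_q((1/θ))`: formal Laurent series over `F = 𝔽_q`, the uniformizer being `1/θ`. -/
def Kinf : Type _ := LaurentSeries F

namespace Kinf

instance : Field (Kinf F) := inferInstanceAs (Field (LaurentSeries F))

instance : Algebra F (Kinf F) := inferInstanceAs (Algebra F (LaurentSeries F))

/-- The `1/θ`-adic valuation, with its topology. -/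
instance valued : Valued (Kinf F) (WithZero (Multiplicative ℤ)) :=
  inferInstanceAs (Valued (LaurentSeries F) (WithZero (Multiplicative ℤ)))

instance : CompleteSpace (Kinf F) := inferInstanceAs (CompleteSpace (LaurentSeries F))

/-- The element `θ` of `K_∞`, i.e. the inverse of the uniformizer. -/
def theta : Kinf F := (HahnSeries.single (-1 : ℤ) (1 : F) : LaurentSeries F)

theorem valuation_theta : (valued F).v (theta F) = WithZero.exp (1 : ℤ) := by
  have h := LaurentSeries.valuation_single_zpow F (-1)
  rw [neg_neg] at h
  exact h

theorem one_lt_card : (1 : NNReal) < (Fintype.card F : NNReal) := by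
  exact_mod_cast Fintype.one_lt_card

open MonoidWithZeroHom in
/-- The valuation is made real-valued by `|α| = q ^ (-v_∞(α))`. -/
instance rankOne : Valuation.RankOne (valued F).v where
  hom' := (WithZeroMulInt.toNNReal (one_lt_card F).ne_bot).comp ValueGroup₀.embedding
  strictMono' := (WithZeroMulInt.toNNReal_strictMono (one_lt_card F)).comp
    ValueGroup₀.embedding_strictMono
  exists_val_nontrivial := by
    refine ⟨theta F, ?_⟩
    rw [valuation_theta]
    exact ⟨WithZero.exp_ne_zero, by decide⟩

instance nontriviallyNormedField : NontriviallyNormedField (Kinf F) :=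
  Valued.toNontriviallyNormedField (Kinf F) (WithZero (Multiplicative ℤ))

instance : IsUltrametricDist (Kinf F) :=
  ⟨fun x y z => by
    have h := Valuation.norm_add_le (valued F).v (x - y) (y - z)
    rw [sub_add_sub_cancel] at h
    exact h⟩

theorem norm_theta : ‖theta F‖ = (Fintype.card F : ℝ) := by
  change ((WithZeroMulInt.toNNReal (one_lt_card F).ne_bot
    (MonoidWithZeroHom.ValueGroup₀.embedding ((valued F).v.restrict (theta F))) : NNReal) : ℝ) = _
  rw [Valuation.restrict_def, MonoidWithZeroHom.ValueGroup₀.embedding_restrict₀]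
  erw [valuation_theta]
  rw [WithZeroMulInt.toNNReal_neg_apply _ WithZero.exp_ne_zero]
  simp [WithZero.exp]

end Kinf

/-- An algebraic closure of `K_∞`. -/
def AlgKinf : Type _ := AlgebraicClosure (Kinf F)

namespace AlgKinf

instance : Field (AlgKinf F) := inferInstanceAs (Field (AlgebraicClosure (Kinf F)))

instance : Algebra (Kinf F) (AlgKinf F) :=
  inferInstanceAs (Algebra (Kinf F) (AlgebraicClosure (Kinf F)))

instance : IsAlgClosed (AlgKinf F) := inferInstanceAs (IsAlgClosed (AlgebraicClosure (Kinf F)))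

instance : Algebra.IsAlgebraic (Kinf F) (AlgKinf F) :=
  inferInstanceAs (Algebra.IsAlgebraic (Kinf F) (AlgebraicClosure (Kinf F)))

/-- The unique extension of the absolute value of `K_∞`. -/
instance : NormedField (AlgKinf F) := spectralNorm.normedField (Kinf F) (AlgKinf F)

instance : NormedAlgebra (Kinf F) (AlgKinf F) := spectralNorm.normedAlgebra (Kinf F) (AlgKinf F)

end AlgKinf

/-- `ℂ_∞`: the completion of an algebraic closure of `K_∞`. -/
def Cinf : Type _ := UniformSpace.Completion (AlgKinf F)

namespace Cinf

instance : NormedField (Cinf F) := inferInstanceAs (NormedField (UniformSpace.Completion (AlgKinf F)))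

instance : CompleteSpace (Cinf F) :=
  inferInstanceAs (CompleteSpace (UniformSpace.Completion (AlgKinf F)))

instance : NormedAlgebra (AlgKinf F) (Cinf F) :=
  inferInstanceAs (NormedAlgebra (AlgKinf F) (UniformSpace.Completion (AlgKinf F)))

instance : NormedAlgebra (Kinf F) (Cinf F) :=
  inferInstanceAs (NormedAlgebra (Kinf F) (UniformSpace.Completion (AlgKinf F)))

instance : IsScalarTower (Kinf F) (AlgKinf F) (Cinf F) :=
  IsScalarTower.of_algebraMap_eq (congrFun rfl)

instance : Algebra F (Cinf F) := ((algebraMap (Kinf F) (Cinf F)).comp (algebraMap F (Kinf F))).toAlgebra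

instance : IsScalarTower F (Kinf F) (Cinf F) := IsScalarTower.of_algebraMap_eq (congrFun rfl)

theorem norm_algebraMap_Kinf (x : Kinf F) : ‖algebraMap (Kinf F) (Cinf F) x‖ = ‖x‖ :=
  norm_algebraMap' _ _

instance : IsUltrametricDist (Cinf F) := IsUltrametricDist.of_normedAlgebra (Kinf F)

end Cinf

/-! ### The Carlitz module -/

section Action

variable (R : Type*) [CommRing R] [Algebra F R] [Algebra (Kinf F) R]

/-- The operator `θ + τ` on a `K_∞`-algebra `R`, where `τ x = x ^ q`. -/
def thetaAddTau : Module.End F R :=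
  LinearMap.mulLeft F (algebraMap (Kinf F) R (Kinf.theta F)) +
    (FiniteField.frobeniusAlgHom F R).toLinearMap

/-- The Carlitz action of `A = 𝔽_q[θ]` on a `K_∞`-algebra `R`: the morphism of `𝔽_q`-algebras
`a ↦ C_a` with `C_θ = θ + τ`. (Elements of `A` are written as polynomials `a : F[X]`.) -/
def carlitz : Polynomial F →ₐ[F] Module.End F R := Polynomial.aeval (thetaAddTau F R)

end Action

theorem thetaAddTau_apply {R : Type*} [CommRing R] [Algebra F R] [Algebra (Kinf F) R] (x : R) :
    thetaAddTau F R x = algebraMap (Kinf F) R (Kinf.theta F) * x + x ^ Fintype.card F := by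
  simp [thetaAddTau]

/-- `Λ_C`: the `A`-torsion points of the Carlitz module `C(ℂ_∞)`. -/
def torsion : Set (Cinf F) := {x | ∃ a : Polynomial F, a ≠ 0 ∧ carlitz F (Cinf F) a x = 0}

theorem norm_algebraMap_const (c : F) (hc : c ≠ 0) : ‖algebraMap F (Cinf F) c‖ = 1 := by
  have h1 : algebraMap F (Cinf F) c ^ (Fintype.card F - 1) = 1 := by
    rw [← map_pow, FiniteField.pow_card_sub_one_eq_one c hc, map_one]
  have h2 : ‖algebraMap F (Cinf F) c‖ ^ (Fintype.card F - 1) = 1 := by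
    rw [← norm_pow, h1, norm_one]
  have h3 := Fintype.one_lt_card (α := F)
  exact (pow_eq_one_iff_of_nonneg (norm_nonneg _) (by omega)).mp h2

theorem norm_theta_Cinf :
    ‖algebraMap (Kinf F) (Cinf F) (Kinf.theta F)‖ = (Fintype.card F : ℝ) := by
  rw [Cinf.norm_algebraMap_Kinf, Kinf.norm_theta]

theorem norm_thetaAddTau_gt (x : Cinf F) (hx : (Fintype.card F : ℝ) < ‖x‖) :
    ‖x‖ < ‖thetaAddTau F (Cinf F) x‖ := by
  have hq : (1 : ℝ) < Fintype.card F := by exact_mod_cast Fintype.one_lt_card (α := F)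
  have hx1 : 1 < ‖x‖ := hq.trans hx
  have h2 : ‖x‖ ^ 2 ≤ ‖x‖ ^ Fintype.card F :=
    pow_le_pow_right₀ hx1.le (Fintype.one_lt_card (α := F))
  have h3 : ‖algebraMap (Kinf F) (Cinf F) (Kinf.theta F) * x‖ < ‖x ^ Fintype.card F‖ := by
    rw [norm_mul, norm_pow, norm_theta_Cinf]
    nlinarith
  rw [thetaAddTau_apply, IsUltrametricDist.norm_add_eq_max_of_norm_ne_norm h3.ne,
    max_eq_right h3.le, norm_pow]
  nlinarith

theorem carlitz_C (c : F) (x : Cinf F) :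
    carlitz F (Cinf F) (Polynomial.C c) x = algebraMap F (Cinf F) c * x := by
  simp [carlitz, Algebra.smul_def]

theorem norm_le_norm_carlitz (x : Cinf F) (hx : (Fintype.card F : ℝ) < ‖x‖)
    (n : ℕ) (a : Polynomial F) (hn : a.natDegree ≤ n) (ha : a ≠ 0) :
    ‖x‖ ≤ ‖carlitz F (Cinf F) a x‖ := by
  induction n generalizing a with
  | zero =>
    rw [Polynomial.eq_C_of_natDegree_le_zero hn] at ha ⊢
    rw [carlitz_C, norm_mul, norm_algebraMap_const F _ (fun h => ha (by rw [h, map_zero])), one_mul]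
  | succ n ih =>
    rw [← Polynomial.divX_mul_X_add a]
    by_cases h0 : a.divX = 0
    · rw [h0, zero_mul, zero_add, carlitz_C, norm_mul, norm_algebraMap_const, one_mul]
      intro hc
      apply ha
      rw [← Polynomial.divX_mul_X_add a, h0, hc]
      simp
    · have hd : a.divX.natDegree ≤ n := by
        rw [Polynomial.natDegree_divX_eq_natDegree_tsub_one]
        omega
      have h1 := ih a.divX hd h0
      have h2 := norm_thetaAddTau_gt F _ (hx.trans_le h1)
      have h3 : carlitz F (Cinf F) (a.divX * Polynomial.X) x =
          thetaAddTau F (Cinf F) (carlitz F (Cinf F) a.divX x) := by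
        rw [mul_comm, map_mul]
        simp [carlitz]
      have h4 : ‖algebraMap F (Cinf F) (a.coeff 0) * x‖ ≤ ‖x‖ := by
        by_cases hc : a.coeff 0 = 0
        · rw [hc, map_zero, zero_mul, norm_zero]
          exact norm_nonneg _
        · rw [norm_mul, norm_algebraMap_const F _ hc, one_mul]
      rw [map_add, LinearMap.add_apply, carlitz_C, h3]
      have h5 := h4.trans_lt (h1.trans_lt h2)
      rw [IsUltrametricDist.norm_add_eq_max_of_norm_ne_norm h5.ne', max_eq_left h5.le]
      exact (h1.trans_lt h2).le

theorem norm_le_of_mem_torsion (x : Cinf F) (hx : x ∈ torsion F) :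
    ‖x‖ ≤ (Fintype.card F : ℝ) := by
  obtain ⟨a, ha, h0⟩ := hx
  by_contra hlt
  have h1 := norm_le_norm_carlitz F x (not_le.mp hlt) _ a le_rfl ha
  rw [h0, norm_zero] at h1
  exact hlt (h1.trans (Nat.cast_nonneg _))

/-- `𝔎`: the closure of `Λ_C` in `ℂ_∞`. -/
def frakK : Set (Cinf F) := closure (torsion F)

theorem zero_mem_torsion : (0 : Cinf F) ∈ torsion F := ⟨1, one_ne_zero, map_zero _⟩

theorem norm_le_of_mem_frakK (x : Cinf F) (hx : x ∈ frakK F) : ‖x‖ ≤ (Fintype.card F : ℝ) :=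
  closure_minimal (fun y hy => norm_le_of_mem_torsion F y hy)
    (isClosed_le continuous_norm continuous_const) hx

/-- `C_θ` is surjective on the algebraic closure of `K_∞`. -/
theorem exists_thetaAddTau_eq (y : AlgKinf F) : ∃ z : AlgKinf F,
    thetaAddTau F (Cinf F) (algebraMap (AlgKinf F) (Cinf F) z) =
      algebraMap (AlgKinf F) (Cinf F) y := by
  let t : AlgKinf F := algebraMap (Kinf F) (AlgKinf F) (Kinf.theta F)
  have hq := Fintype.one_lt_card (α := F)
  have hdeg : (Polynomial.X ^ Fintype.card F +
      (Polynomial.C t * Polynomial.X - Polynomial.C y) : Polynomial (AlgKinf F)).degree ≠ 0 := by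
    have h1 : (Polynomial.C t * Polynomial.X - Polynomial.C y :
        Polynomial (AlgKinf F)).degree < Fintype.card F := by
      rw [sub_eq_add_neg, ← Polynomial.C_neg]
      exact Polynomial.degree_linear_le.trans_lt (by exact_mod_cast hq)
    rw [Polynomial.degree_add_eq_left_of_degree_lt (by rwa [Polynomial.degree_X_pow]),
      Polynomial.degree_X_pow]
    exact_mod_cast (by omega)
  obtain ⟨z, hz⟩ := IsAlgClosed.exists_root _ hdeg
  refine ⟨z, ?_⟩
  have hz' : t * z + z ^ Fintype.card F = y := by
    simp [Polynomial.IsRoot] at hz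
    linear_combination hz
  rw [thetaAddTau_apply, ← hz', map_add, map_mul, map_pow,
    ← IsScalarTower.algebraMap_apply (Kinf F) (AlgKinf F) (Cinf F)]

theorem exists_ne_zero_thetaAddTau_eq_zero : ∃ z : AlgKinf F, z ≠ 0 ∧
    thetaAddTau F (Cinf F) (algebraMap (AlgKinf F) (Cinf F) z) = 0 := by
  let t : AlgKinf F := algebraMap (Kinf F) (AlgKinf F) (Kinf.theta F)
  have hq := Fintype.one_lt_card (α := F)
  have ht : t ≠ 0 := by
    intro h
    have h1 : algebraMap (AlgKinf F) (Cinf F) t = 0 := by rw [h, map_zero]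
    rw [← IsScalarTower.algebraMap_apply (Kinf F) (AlgKinf F) (Cinf F)] at h1
    have h2 := norm_theta_Cinf F
    rw [h1, norm_zero] at h2
    have : (0 : ℝ) < Fintype.card F := by exact_mod_cast (by omega)
    linarith
  obtain ⟨z, hz⟩ := IsAlgClosed.exists_pow_nat_eq (-t) (n := Fintype.card F - 1) (by omega)
  refine ⟨z, ?_, ?_⟩
  · rintro rfl
    rw [zero_pow (by omega)] at hz
    exact ht (neg_eq_zero.mp hz.symm)
  · have h1 : t * z + z ^ Fintype.card F = 0 := by
      have : z ^ Fintype.card F = z ^ (Fintype.card F - 1) * z := by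
        rw [← pow_succ, Nat.sub_add_cancel hq.le]
      rw [this, hz]
      ring
    rw [thetaAddTau_apply, IsScalarTower.algebraMap_apply (Kinf F) (AlgKinf F) (Cinf F), ← map_pow,
      ← map_mul, ← map_add, h1, map_zero]

theorem torsion_infinite : (torsion F).Infinite := by
  obtain ⟨z, hz, hz0⟩ := exists_ne_zero_thetaAddTau_eq_zero F
  choose g hg using exists_thetaAddTau_eq F
  let T := thetaAddTau F (Cinf F)
  let u : ℕ → Cinf F := fun n => algebraMap (AlgKinf F) (Cinf F) (g^[n] z)
  have hu : ∀ n m, (T ^ n) (u (n + m)) = u m := by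
    intro n
    induction n with
    | zero => intro m; simp
    | succ n ih =>
      intro m
      rw [pow_succ, Module.End.mul_apply]
      have : T (u (n + 1 + m)) = u (n + m) := by
        have : g^[n + 1 + m] z = g (g^[n + m] z) := by
          rw [add_right_comm, Function.iterate_succ_apply']
        simp only [u, this]
        exact hg _
      rw [this, ih]
  have hne : u 0 ≠ 0 := by
    simpa [u] using hz
  have hT : T (u 0) = 0 := hz0
  have h1 : ∀ n, (T ^ (n + 1)) (u n) = 0 := by
    intro n
    have := hu n 0
    rw [add_zero] at this
    rw [pow_succ', Module.End.mul_apply, this, hT]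
  have hinj : Function.Injective u := by
    intro a b hab
    by_contra hne'
    wlog hlt : a < b generalizing a b
    · exact this hab.symm (Ne.symm hne') (by omega)
    obtain ⟨k, rfl⟩ := Nat.exists_eq_add_of_lt hlt
    have h2 := hu (a + k + 1) 0
    rw [add_zero, ← hab, show a + k + 1 = k + (a + 1) by ring, pow_add, Module.End.mul_apply, h1,
      map_zero] at h2
    exact hne h2.symm
  refine (Set.infinite_range_of_injective hinj).mono ?_
  rintro _ ⟨n, rfl⟩
  refine ⟨Polynomial.X ^ (n + 1), pow_ne_zero _ Polynomial.X_ne_zero, ?_⟩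
  rw [carlitz, map_pow, Polynomial.aeval_X]
  exact h1 n

theorem frakK_infinite : (frakK F).Infinite := (torsion_infinite F).mono subset_closure

instance : Nonempty (frakK F) := ⟨⟨0, subset_closure (zero_mem_torsion F)⟩⟩

variable {F} in
/-- The Carlitz period attached to a `(q-1)`-st root `ρ` of `θ - θ^q`:
`π̃ = ρ ∏_{i ≥ 1} (1 - (θ^{q^i} - θ) / (θ^{q^{i+1}} - θ))`. -/
def period (ρ : Cinf F) : Cinf F :=
  let θ : Cinf F := algebraMap (Kinf F) (Cinf F) (Kinf.theta F)
  let q := Fintype.card F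
  ρ * ∏' i : ℕ, (1 - (θ ^ q ^ (i + 1) - θ) / (θ ^ q ^ (i + 2) - θ))

/-- The product defining the Carlitz period converges. -/
theorem multipliable_period : Multipliable fun i : ℕ =>
    (1 - (algebraMap (Kinf F) (Cinf F) (Kinf.theta F) ^ Fintype.card F ^ (i + 1) -
        algebraMap (Kinf F) (Cinf F) (Kinf.theta F)) /
      (algebraMap (Kinf F) (Cinf F) (Kinf.theta F) ^ Fintype.card F ^ (i + 2) -
        algebraMap (Kinf F) (Cinf F) (Kinf.theta F))) := by
  set θ : Cinf F := algebraMap (Kinf F) (Cinf F) (Kinf.theta F) with hθ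
  set q := Fintype.card F with hq'
  have hq : 1 < q := Fintype.one_lt_card (α := F)
  have hn : ‖θ‖ = (q : ℝ) := norm_theta_Cinf F
  have hqR : (1 : ℝ) < q := by exact_mod_cast hq
  have key : ∀ i : ℕ, ‖θ ^ q ^ (i + 1) - θ‖ = (q : ℝ) ^ q ^ (i + 1) := by
    intro i
    have h1 : ‖θ‖ < ‖θ ^ q ^ (i + 1)‖ := by
      rw [norm_pow, hn]
      exact lt_self_pow₀ hqR (Nat.one_lt_pow (by omega) hq)
    rw [sub_eq_add_neg, IsUltrametricDist.norm_add_eq_max_of_norm_ne_norm (by rw [norm_neg]; exact h1.ne'),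
      norm_neg, max_eq_left h1.le, norm_pow, hn]
  simp_rw [sub_eq_add_neg (1 : Cinf F)]
  apply multipliable_one_add_of_summable
  refine Summable.of_nonneg_of_le (fun _ => norm_nonneg _) (fun i => ?_)
    (summable_geometric_of_lt_one (r := (q : ℝ)⁻¹) (by positivity) (inv_lt_one_of_one_lt₀ hqR))
  rw [norm_neg, norm_div, key, key (i + 1)]
  have h2 : i + q ^ (i + 1) ≤ q ^ (i + 2) := by
    have h3 : i < q ^ (i + 1) := (Nat.lt_succ_self i).trans (Nat.lt_pow_self hq)
    have h4 : q ^ (i + 2) = q ^ (i + 1) * q := pow_succ _ _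
    nlinarith
  rw [div_le_iff₀ (by positivity), inv_pow, inv_mul_eq_div, le_div_iff₀ (by positivity), ← pow_add,
    add_comm]
  exact pow_le_pow_right₀ hqR.le h2

/-! ### The Banach spaces `𝔹_s(E)` -/

variable {F}

variable (E : IntermediateField (Kinf F) (Cinf F)) (s : ℕ)

/-- The polynomial ring `E[X_1, …, X_s]`, to be normed by the sup-norm over `𝔎^s`. -/
def Poly : Type _ := MvPolynomial (Fin s) E

namespace Poly

instance : CommRing (Poly E s) := inferInstanceAs (CommRing (MvPolynomial (Fin s) E))

instance : Algebra E (Poly E s) := inferInstanceAs (Algebra E (MvPolynomial (Fin s) E))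

instance : Algebra (Kinf F) (Poly E s) :=
  inferInstanceAs (Algebra (Kinf F) (MvPolynomial (Fin s) E))

instance : Algebra F (Poly E s) := inferInstanceAs (Algebra F (MvPolynomial (Fin s) E))

/-- The indeterminate `X_j`. -/
def X (j : Fin s) : Poly E s := (MvPolynomial.X j : MvPolynomial (Fin s) E)

/-- Evaluation of a polynomial at a point of `ℂ_∞^s`. -/
def evalAt (x : Fin s → Cinf F) : Poly E s →ₐ[E] Cinf F :=
  (MvPolynomial.aeval x : MvPolynomial (Fin s) E →ₐ[E] Cinf F)

/-- The norm `‖P‖ = sup { |P(x)| : x ∈ 𝔎^s }`. -/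
def supNorm (P : Poly E s) : ℝ := ⨆ x : Fin s → frakK F, ‖evalAt E s (fun j => (x j : Cinf F)) P‖

theorem exists_bound (P : Poly E s) : ∃ B : ℝ, ∀ x : Fin s → Cinf F,
    (∀ j, ‖x j‖ ≤ Fintype.card F) → ‖evalAt E s x P‖ ≤ B := by
  induction P using MvPolynomial.induction_on with
  | C a =>
    refine ⟨‖(a : Cinf F)‖, fun x _ => ?_⟩
    have : evalAt E s x (MvPolynomial.C a : MvPolynomial (Fin s) E) = (a : Cinf F) :=
      MvPolynomial.aeval_C (R := E) x a
    rw [this]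
  | add p q hp hq =>
    obtain ⟨B, hB⟩ := hp
    obtain ⟨B', hB'⟩ := hq
    refine ⟨B + B', fun x hx => ?_⟩
    have : evalAt E s x (p + q : MvPolynomial (Fin s) E) = evalAt E s x p + evalAt E s x q :=
      map_add (evalAt E s x) _ _
    rw [this]
    exact (norm_add_le _ _).trans (add_le_add (hB x hx) (hB' x hx))
  | mul_X p j hp =>
    obtain ⟨B, hB⟩ := hp
    refine ⟨B * Fintype.card F, fun x hx => ?_⟩
    have : evalAt E s x (p * MvPolynomial.X j : MvPolynomial (Fin s) E) = evalAt E s x p * x j := by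
      refine (map_mul (evalAt E s x) p (X E s j)).trans ?_
      congr 1
      exact MvPolynomial.aeval_X (R := E) x j
    rw [this, norm_mul]
    exact mul_le_mul (hB x hx) (hx j) (norm_nonneg _) ((norm_nonneg _).trans (hB x hx))

theorem bddAbove (P : Poly E s) : BddAbove
    (Set.range fun x : Fin s → frakK F => ‖evalAt E s (fun j => (x j : Cinf F)) P‖) := by
  obtain ⟨B, hB⟩ := exists_bound E s P
  refine ⟨B, ?_⟩
  rintro _ ⟨x, rfl⟩
  exact hB _ fun j => norm_le_of_mem_frakK F _ (x j).2

theorem norm_evalAt_le (P : Poly E s) (x : Fin s → frakK F) :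
    ‖evalAt E s (fun j => (x j : Cinf F)) P‖ ≤ supNorm E s P :=
  le_ciSup (bddAbove E s P) x

theorem eq_zero_of_supNorm (P : Poly E s) (h : supNorm E s P = 0) : P = 0 := by
  let ι : E →+* Cinf F := algebraMap E (Cinf F)
  have hev : ∀ x ∈ Set.pi Set.univ (fun _ : Fin s => frakK F),
      MvPolynomial.eval x (MvPolynomial.map ι (P : MvPolynomial (Fin s) E)) =
        MvPolynomial.eval x 0 := by
    intro x hx
    have h1 := norm_evalAt_le E s P fun j => ⟨x j, hx j (Set.mem_univ j)⟩
    rw [h] at h1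
    have h2 := norm_le_zero_iff.mp h1
    exact (MvPolynomial.eval_map ι x (P : MvPolynomial (Fin s) E)).trans (h2.trans (map_zero _).symm)
  have h3 := MvPolynomial.funext_set _ (fun _ => frakK_infinite F) hev
  exact MvPolynomial.map_injective ι ι.injective (h3.trans (map_zero _).symm)

/-- The sup-norm makes `E[X_1, …, X_s]` a normed space over `E`. -/
instance : NormedAddCommGroup (Poly E s) :=
  AddGroupNorm.toNormedAddCommGroup
    { toFun := supNorm E s
      map_zero' := by simp [supNorm]
      add_le' := fun P Q => ciSup_le fun x => by
        rw [map_add]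
        exact (norm_add_le _ _).trans
          (add_le_add (norm_evalAt_le E s P x) (norm_evalAt_le E s Q x))
      neg' := fun P => by simp [supNorm]
      eq_zero_of_map_eq_zero' := eq_zero_of_supNorm E s }

theorem norm_def (P : Poly E s) :
    ‖P‖ = ⨆ x : Fin s → frakK F, ‖evalAt E s (fun j => (x j : Cinf F)) P‖ := rfl

instance : NormedSpace E (Poly E s) where
  norm_smul_le c P := ciSup_le fun x => by
    rw [map_smul, Algebra.smul_def, norm_mul]
    exact mul_le_mul_of_nonneg_left (norm_evalAt_le E s P x) (norm_nonneg _)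

end Poly

/-- `𝔹_s(E)`: the completion of `E[X_1, …, X_s]` for the sup-norm over `𝔎^s`. -/
abbrev Banach : Type _ := UniformSpace.Completion (Poly E s)

/-! ### The polynomials `H_N` and `G_N` -/

section Polynomials

variable (F)

/-- `l_q(N)`: the sum of the base-`q` digits of `N`. -/
def digitSum (N : ℕ) : ℕ := (Nat.digits (Fintype.card F) N).sum

variable {R : Type*} [CommRing R] [Algebra F R] [Algebra (Kinf F) R]

/-- `H_N(x) = ∏_i C_{θ^i}(x)^{N_i}`, where `N = ∑_i N_i q^i` in base `q`. -/
def H (N : ℕ) (x : R) : R :=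
  ∏ i ∈ Finset.range (Nat.digits (Fintype.card F) N).length,
    (carlitz F R (Polynomial.X ^ i) x) ^ (Nat.digits (Fintype.card F) N).getD i 0

/-- `G_N(x) = π^{l_q(N)} ∏_i C_{θ^i}(x)^{N_i}`, where `N = ∑_i N_i q^i` in base `q`. -/
def G (π : R) (N : ℕ) (x : R) : R := π ^ digitSum F N * H F N x

end Polynomials

/-- The product `H_{N_1}(X_1) ⋯ H_{N_s}(X_s)` in `E[X_1, …, X_s]`. -/
def HProd (N : Fin s → ℕ) : Poly E s := ∏ j, H F (N j) (Poly.X E s j)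

/-- The field `L = K_∞(π̃)`. -/
def fieldL (ρ : Cinf F) : IntermediateField (Kinf F) (Cinf F) :=
  IntermediateField.adjoin (Kinf F) {period ρ}

/-- The element `π = θ / π̃` of `L`, as an element of a field `E` containing `L`. -/
def uniformizer (ρ : Cinf F) (hL : fieldL ρ ≤ E) : E :=
  ⟨algebraMap (Kinf F) (Cinf F) (Kinf.theta F) / period ρ,
    E.div_mem (E.algebraMap_mem _) (hL (IntermediateField.mem_adjoin_simple_self _ _))⟩

/-- The product `G_{N_1}(X_1) ⋯ G_{N_s}(X_s)` in `E[X_1, …, X_s]`. -/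
def GProd (ρ : Cinf F) (hL : fieldL ρ ≤ E) (N : Fin s → ℕ) : Poly E s :=
  ∏ j, G F (algebraMap E (Poly E s) (uniformizer E ρ hL)) (N j) (Poly.X E s j)

end Carlitz

/-! Let q be the cardinality of `F` and r = q^{1/(q-1)}. If x is a torsion point, so is every
C_{θ^i}(x), and comparing θx with x^q shows that torsion points have absolute value at most r; by
continuity |H_N| ≤ r^{l_q(N)} on 𝔎.

The substance is the reverse estimate. Choose λ with λ^{q-1} = -θ, so |λ| = r. Then C_θ(λy) =
-θλ(y^q - y), so a torsion point λy satisfies |y^q - y| ≤ 1/q, and y is congruent to an element of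
`F` modulo the maximal ideal. Thus a torsion point x has residues p_i ∈ `F`, those of C_{θ^i}(x)/λ,
and every finite string of residues occurs (`exists_torsion_carlitz_approx`). Modulo the maximal
ideal H_N(x)/λ^{l_q(N)} becomes the monomial ∏ p_i^{N_i}, whose exponents are digits, hence less
than q. Such monomials are independent as functions on a power of `F`, and `exists_dual_prod_pow`
extracts their coefficients by weights in `F`, which have absolute value at most 1. So no
cancellation can push a finite sum below its largest term at all torsion points
(`exists_torsion_le_norm_sum`).

Since H_N is monic of degree N, the products also span the polynomials, and
`IsOrthogonalFamily.completion` passes to 𝔹_s(E). The statement for G_N is a rescaling, because |π|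
= 1/r. -/

namespace Carlitz

/-! ### Orthogonal bases of completions -/

section OrthogonalBasis

variable {K V ι : Type*} [NormedField K] [NormedAddCommGroup V] [NormedSpace K V]

/-- A family `b` is orthogonal with norms `w` if `‖∑ aᵢ bᵢ‖ = max ‖aᵢ‖ wᵢ` for all finite sums. -/
structure IsOrthogonalFamily (K : Type*) {V ι : Type*} [NormedField K] [NormedAddCommGroup V]
    [NormedSpace K V] (b : ι → V) (w : ι → ℝ) : Prop where
  pos : ∀ i, 0 < w i
  norm_sum_le : ∀ (S : Finset ι) (a : ι → K) (M : ℝ), 0 ≤ M → (∀ i ∈ S, ‖a i‖ * w i ≤ M) →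
    ‖∑ i ∈ S, a i • b i‖ ≤ M
  le_norm_sum : ∀ (S : Finset ι) (a : ι → K), ∀ i ∈ S, ‖a i‖ * w i ≤ ‖∑ i ∈ S, a i • b i‖

namespace IsOrthogonalFamily

variable {b : ι → V} {w : ι → ℝ}

theorem linearIndependent (h : IsOrthogonalFamily K b w) : LinearIndependent K b := by
  rw [linearIndependent_iff']
  intro S a h0 i hi
  have h1 := h.le_norm_sum S a i hi
  rw [h0, norm_zero] at h1
  have h2 := h.pos i
  exact norm_le_zero_iff.mp (by nlinarith [norm_nonneg (a i)])

theorem norm_eq (h : IsOrthogonalFamily K b w) (i : ι) : ‖b i‖ = w i := by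
  apply le_antisymm
  · simpa using h.norm_sum_le {i} 1 (w i) (h.pos i).le (by simp)
  · simpa using h.le_norm_sum {i} 1 i (by simp)

/-- This makes the coordinate functionals bounded, which allows their extension to the completion.
-/
theorem norm_repr_mul_le (h : IsOrthogonalFamily K b w) (B : Module.Basis ι K V)
    (hB : ∀ i, B i = b i) (v : V) (i : ι) : ‖B.repr v i‖ * w i ≤ ‖v‖ := by
  by_cases hi : i ∈ (B.repr v).support
  · have h1 := h.le_norm_sum (B.repr v).support (B.repr v) i hi
    have h2 := B.linearCombination_repr v
    rw [Finsupp.linearCombination_apply, Finsupp.sum] at h2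
    simp_rw [hB] at h2
    rwa [h2] at h1
  · rw [Finsupp.notMem_support_iff.mp hi, norm_zero, zero_mul]
    exact norm_nonneg v

theorem coe_norm_sum_le (h : IsOrthogonalFamily K b w) (S : Finset ι) (a : ι → K) (M : ℝ)
    (hM : 0 ≤ M) (ha : ∀ i ∈ S, ‖a i‖ * w i ≤ M) :
    ‖∑ i ∈ S, a i • (b i : UniformSpace.Completion V)‖ ≤ M := by
  have h1 : ∑ i ∈ S, a i • (b i : UniformSpace.Completion V) =
      ((∑ i ∈ S, a i • b i : V) : UniformSpace.Completion V) := by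
    rw [← UniformSpace.Completion.coe_toComplL (𝕜 := K), map_sum]
    simp
  rw [h1, UniformSpace.Completion.norm_coe]
  exact h.norm_sum_le S a M hM ha

/-- An orthogonal family which spans a normed space is an orthogonal basis of its completion. -/
theorem completion [CompleteSpace K] [Nonempty ι] (h : IsOrthogonalFamily K b w)
    (hspan : ⊤ ≤ Submodule.span K (Set.range b)) (P : UniformSpace.Completion V) :
    (∃! f : ι → K, HasSum (fun i => f i • (b i : UniformSpace.Completion V)) P) ∧
      ∀ f : ι → K, HasSum (fun i => f i • (b i : UniformSpace.Completion V)) P →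
        Tendsto (fun i => ‖f i‖ * w i) cofinite (𝓝 0) ∧
          IsGreatest (Set.range fun i => ‖f i‖ * w i) ‖P‖ := by
  classical
  let B : Module.Basis ι K V := Module.Basis.mk h.linearIndependent hspan
  have hB : ∀ i, B i = b i := Module.Basis.mk_apply _ _
  let φ : ι → V →L[K] K := fun i => (B.coord i).mkContinuous (w i)⁻¹ fun v => by
    rw [inv_mul_eq_div, le_div_iff₀ (h.pos i)]
    exact h.norm_repr_mul_le B hB v i
  let ψ : ι → UniformSpace.Completion V →L[K] K := fun i =>
    (φ i).extend (UniformSpace.Completion.toComplL (𝕜 := K) (E := V))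
  have hψ : ∀ i (v : V), ψ i (v : UniformSpace.Completion V) = B.repr v i := fun i v =>
    (φ i).extend_eq (UniformSpace.Completion.denseRange_coe)
      (UniformSpace.Completion.isUniformInducing_coe V) v
  have hψb : ∀ i j, ψ i (b j : UniformSpace.Completion V) = if i = j then 1 else 0 := by
    intro i j
    rw [hψ, ← hB, B.repr_self, Finsupp.single_apply]
    simp [eq_comm]
  have hle : ∀ i (Q : UniformSpace.Completion V), ‖ψ i Q‖ * w i ≤ ‖Q‖ := by
    intro i Q
    induction Q using UniformSpace.Completion.induction_on with
    | hp => exact isClosed_le (((ψ i).continuous.norm).mul continuous_const) continuous_norm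
    | ih v =>
      rw [hψ, UniformSpace.Completion.norm_coe]
      exact h.norm_repr_mul_le B hB v i
  have happrox : ∀ (Q : UniformSpace.Completion V) (ε : ℝ), 0 < ε → ∃ v : V,
      ‖Q - (v : UniformSpace.Completion V)‖ < ε := by
    intro Q ε hε
    obtain ⟨v, hv⟩ := UniformSpace.Completion.denseRange_coe.exists_dist_lt Q hε
    exact ⟨v, by rwa [← dist_eq_norm]⟩
  -- Uniqueness: the extended coordinate functionals are continuous, so they may be applied to the
  -- sum term by term.
  have hcoef : ∀ f : ι → K, HasSum (fun i => f i • (b i : UniformSpace.Completion V)) P →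
      f = fun i => ψ i P := by
    intro f hf
    funext i
    have h1 := hf.mapL (ψ i)
    refine (h1.unique ?_).symm
    have h2 := hasSum_ite_eq i (f i)
    convert! h2 using 2 with j
    rw [map_smul, hψb, smul_eq_mul]
    by_cases hij : j = i
    · simp [hij]
    · rw [if_neg (Ne.symm hij), if_neg hij, mul_zero]
  have hsum : HasSum (fun i => ψ i P • (b i : UniformSpace.Completion V)) P := by
    rw [HasSum, SummationFilter.unconditional_filter, Metric.tendsto_atTop]
    intro ε hε
    obtain ⟨v, hv⟩ := happrox P (ε / 2) (half_pos hε)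
    refine ⟨(B.repr v).support, fun S hS => ?_⟩
    have hvsum : (v : UniformSpace.Completion V) =
        ∑ i ∈ S, B.repr v i • (b i : UniformSpace.Completion V) := by
      have h2 := B.linearCombination_repr v
      rw [Finsupp.linearCombination_apply, Finsupp.sum_of_support_subset _ hS _ (by simp)] at h2
      simp_rw [hB] at h2
      conv_lhs => rw [← h2]
      rw [← UniformSpace.Completion.coe_toComplL (𝕜 := K), map_sum]
      simp
    -- As `v` is its own partial sum over `S`, replacing `P` by `P - v` leaves the error unchanged.
    -- Both terms on the right are then at most `‖P - v‖`, whence the `ε / 2`.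
    have h3 : ∑ i ∈ S, ψ i P • (b i : UniformSpace.Completion V) - P =
        ∑ i ∈ S, ψ i (P - v) • (b i : UniformSpace.Completion V) - (P - v) := by
      simp_rw [map_sub, sub_smul, hψ, Finset.sum_sub_distrib, ← hvsum]
      abel
    rw [dist_eq_norm, h3]
    have h4 := h.coe_norm_sum_le S (fun i => ψ i (P - v)) _ (norm_nonneg (P - v))
      fun i _ => hle i _
    linarith [norm_sub_le (∑ i ∈ S, ψ i (P - v) • (b i : UniformSpace.Completion V)) (P - v)]
  refine ⟨⟨fun i => ψ i P, hsum, fun f hf => hcoef f hf⟩, ?_⟩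
  intro f hf
  obtain rfl := hcoef f hf
  have hlim : Tendsto (fun i => ‖ψ i P‖ * w i) cofinite (𝓝 0) := by
    rw [Metric.tendsto_nhds]
    intro ε hε
    obtain ⟨v, hv⟩ := happrox P ε hε
    -- Off the support of `v`, the coordinates of `P` and `P - v` agree.
    refine ((B.repr v).support.finite_toSet).subset fun i hi => ?_
    by_contra hi'
    apply hi
    have h1 := hle i (P - v)
    rw [map_sub, hψ, Finsupp.notMem_support_iff.mp hi', sub_zero] at h1
    have h2 := h.pos i
    rw [Set.mem_ofPred_eq, Real.dist_0_eq_abs, abs_of_nonneg (by positivity)]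
    exact h1.trans_lt hv
  refine ⟨hlim, ?_, ?_⟩
  · have hub : ∀ M, 0 ≤ M → (∀ i, ‖ψ i P‖ * w i ≤ M) → ‖P‖ ≤ M := by
      intro M hM hi
      exact le_of_tendsto' hsum.norm fun S => h.coe_norm_sum_le S _ M hM fun i _ => hi i
    obtain ⟨i, hi⟩ : ∃ i, ∀ j, ‖ψ j P‖ * w j ≤ ‖ψ i P‖ * w i := by
      by_cases h0 : ∀ j, ‖ψ j P‖ * w j = 0
      · exact ⟨Classical.arbitrary ι, fun j => by rw [h0, h0]⟩
      · push Not at h0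
        obtain ⟨k, hk⟩ := h0
        have hk' : 0 < ‖ψ k P‖ * w k :=
          lt_of_le_of_ne (mul_nonneg (norm_nonneg _) (h.pos k).le) hk.symm
        -- By `hlim` only finitely many terms reach a given positive one, so the supremum is
        -- attained among them.
        have hfin : {j | ‖ψ k P‖ * w k ≤ ‖ψ j P‖ * w j}.Finite := by
          have h5 := hlim.eventually (gt_mem_nhds hk')
          rw [eventually_cofinite] at h5
          simpa only [not_lt] using h5
        obtain ⟨i, hi, hmax⟩ := hfin.exists_maximalFor (fun j => ‖ψ j P‖ * w j) _ ⟨k, le_refl (‖ψ k P‖ * w k)⟩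
        refine ⟨i, fun j => ?_⟩
        by_cases hj : ‖ψ k P‖ * w k ≤ ‖ψ j P‖ * w j
        · by_contra hlt
          exact hlt (hmax hj (not_le.mp hlt).le)
        · exact (not_le.mp hj).le.trans hi
    refine ⟨i, le_antisymm (hle i P) (hub _ (mul_nonneg (norm_nonneg _) (h.pos i).le) hi)⟩
  · rintro _ ⟨i, rfl⟩
    exact hle i P

/-- Rescaling an orthogonal family. -/
theorem smul (h : IsOrthogonalFamily K b w) (c : ι → K) (hc : ∀ i, c i ≠ 0) :
    IsOrthogonalFamily K (fun i => c i • b i) (fun i => ‖c i‖ * w i) where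
  pos i := mul_pos (norm_pos_iff.mpr (hc i)) (h.pos i)
  norm_sum_le S a M hM ha := by
    simp_rw [smul_smul]
    refine h.norm_sum_le S (fun i => a i * c i) M hM fun i hi => ?_
    rw [norm_mul, mul_assoc]
    exact ha i hi
  le_norm_sum S a i hi := by
    simp_rw [smul_smul]
    have := h.le_norm_sum S (fun i => a i * c i) i hi
    rwa [norm_mul, mul_assoc] at this

end IsOrthogonalFamily

end OrthogonalBasis

/-! ### Reduced polynomial functions over a finite field -/

section Reduced

variable (F : Type*) [Field F] [Fintype F]

/-- Lagrange interpolation at all points of `F` reproduces X^n for n < q; its coefficient of X^m is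
a fixed linear combination of the values c^n. -/
theorem exists_dual_pow (m : ℕ) : ∃ w : F → F, ∀ n < Fintype.card F,
    ∑ c, w c * c ^ n = if n = m then 1 else 0 := by
  classical
  refine ⟨fun c => (Lagrange.basis Finset.univ id c).coeff m, fun n hn => ?_⟩
  have h1 := Lagrange.eq_interpolate (f := (Polynomial.X ^ n : Polynomial F))
    (s := (Finset.univ : Finset F)) (v := id) Function.injective_id.injOn (by
      rw [Polynomial.degree_X_pow]
      exact_mod_cast hn)
  have h2 := congrArg (fun P => Polynomial.coeff P m) h1
  simp only [Lagrange.interpolate_apply, Polynomial.finsetSum_coeff, Polynomial.coeff_C_mul,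
    Polynomial.coeff_X_pow, Polynomial.eval_pow, Polynomial.eval_X, id] at h2
  simp_rw [mul_comm _ (_ ^ n), ← h2, eq_comm]

/-- Coefficient extraction for polynomials which have degree less than `q` in each variable. -/
theorem exists_dual_prod_pow {σ : Type*} [Fintype σ] [DecidableEq σ] (m : σ → ℕ) : ∃ w : (σ → F) → F,
    ∀ n : σ → ℕ, (∀ k, n k < Fintype.card F) →
      ∑ p, w p * ∏ k, p k ^ n k = if n = m then 1 else 0 := by
  classical
  choose u hu using exists_dual_pow F
  refine ⟨fun p => ∏ k, u (m k) (p k), fun n hn => ?_⟩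
  simp_rw [← Finset.prod_mul_distrib]
  rw [← Fintype.prod_sum fun k c => u (m k) c * c ^ n k]
  simp_rw [fun k => hu (m k) (n k) (hn k)]
  by_cases h : n = m
  · simp [h]
  · rw [if_neg h]
    obtain ⟨k, hk⟩ := Function.ne_iff.mp h
    exact Finset.prod_eq_zero (Finset.mem_univ k) (if_neg hk)

end Reduced

/-! ### Digits -/

section Digits

/-- Padding with zero digits lets numbers with different digit lengths share one index range. -/
theorem prod_range_getD {M : Type*} [CommMonoid M] (L : List ℕ) (f : ℕ → ℕ → M)
    (hf : ∀ i, f i 0 = 1) {n : ℕ} (hn : L.length ≤ n) :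
    ∏ i ∈ Finset.range L.length, f i (L.getD i 0) = ∏ i ∈ Finset.range n, f i (L.getD i 0) := by
  refine Finset.prod_subset (Finset.range_subset_range.mpr hn) fun i _ hi => ?_
  rw [List.getD_eq_default _ _ (by simpa using hi), hf]

theorem sum_range_getD_mul_pow (b : ℕ) (L : List ℕ) :
    ∑ i ∈ Finset.range L.length, L.getD i 0 * b ^ i = Nat.ofDigits b L := by
  induction L with
  | nil => simp
  | cons d L ih =>
    rw [List.length_cons, Finset.sum_range_succ', Nat.ofDigits_cons, ← ih, Finset.mul_sum]
    simp only [List.getD_cons_succ, List.getD_cons_zero, pow_zero, mul_one]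
    rw [add_comm]
    congr 1
    exact Finset.sum_congr rfl fun i _ => by ring

theorem sum_range_getD (L : List ℕ) : ∑ i ∈ Finset.range L.length, L.getD i 0 = L.sum := by
  simpa [Nat.ofDigits_one] using sum_range_getD_mul_pow 1 L

theorem digits_getD_injOn (b : ℕ) {n M N : ℕ}
    (hM : (b.digits M).length ≤ n) (hN : (b.digits N).length ≤ n)
    (h : ∀ i < n, (b.digits M).getD i 0 = (b.digits N).getD i 0) : M = N := by
  have key : ∀ K, (b.digits K).length ≤ n →
      K = ∑ i ∈ Finset.range n, (b.digits K).getD i 0 * b ^ i := by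
    intro K hK
    rw [← Finset.sum_subset (Finset.range_subset_range.mpr hK), sum_range_getD_mul_pow,
      Nat.ofDigits_digits]
    intro i _ hi
    rw [List.getD_eq_default _ _ (by simpa using hi), zero_mul]
  rw [key M hM, key N hN]
  exact Finset.sum_congr rfl fun i hi => by rw [h i (Finset.mem_range.mp hi)]

theorem digits_getD_lt {b : ℕ} (hb : 1 < b) (N i : ℕ) : (b.digits N).getD i 0 < b := by
  rw [Nat.getD_digits _ _ hb]
  exact Nat.mod_lt _ (by omega)

end Digits

end Carlitz

namespace Carlitz

/-! ### Ultrametric estimates -/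

section Ultrametric

variable {K : Type*} [NormedField K] [IsUltrametricDist K]

theorem norm_sum_lt_of_forall_lt {ι : Type*} (S : Finset ι) (f : ι → K) {A : ℝ} (hA : 0 < A)
    (h : ∀ i ∈ S, ‖f i‖ < A) : ‖∑ i ∈ S, f i‖ < A :=
  Finset.sum_induction f (fun x => ‖x‖ < A)
    (fun x y hx hy => (IsUltrametricDist.norm_add_le_max x y).trans_lt (max_lt hx hy))
    (by simpa using hA) h

/-- Congruence modulo the maximal ideal of the valuation ring is compatible with products. -/
theorem norm_prod_sub_prod_lt_one {ι : Type*} (S : Finset ι) (f g : ι → K)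
    (hf : ∀ i ∈ S, ‖f i‖ ≤ 1) (hg : ∀ i ∈ S, ‖g i‖ ≤ 1) (h : ∀ i ∈ S, ‖f i - g i‖ < 1) :
    ‖∏ i ∈ S, f i - ∏ i ∈ S, g i‖ < 1 := by
  classical
  induction S using Finset.induction_on with
  | empty => simp
  | insert i S hi ih =>
    simp only [Finset.mem_insert, forall_eq_or_imp] at hf hg h
    rw [Finset.prod_insert hi, Finset.prod_insert hi,
      show f i * ∏ j ∈ S, f j - g i * ∏ j ∈ S, g j =
        f i * (∏ j ∈ S, f j - ∏ j ∈ S, g j) + (f i - g i) * ∏ j ∈ S, g j by ring]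
    refine (IsUltrametricDist.norm_add_le_max _ _).trans_lt (max_lt ?_ ?_)
    · rw [norm_mul]
      exact mul_lt_one_of_nonneg_of_lt_one_right hf.1 (norm_nonneg _) (ih hf.2 hg.2 h.2)
    · rw [norm_mul, norm_prod]
      exact mul_lt_one_of_nonneg_of_lt_one_left (norm_nonneg _) h.1
        (Finset.prod_le_one (fun _ _ => norm_nonneg _) hg.2)

theorem norm_pow_sub_pow_lt_one (x y : K) (hx : ‖x‖ ≤ 1) (hy : ‖y‖ ≤ 1) (h : ‖x - y‖ < 1)
    (n : ℕ) : ‖x ^ n - y ^ n‖ < 1 := by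
  simpa using norm_prod_sub_prod_lt_one (Finset.range n) (fun _ => x) (fun _ => y)
    (fun _ _ => hx) (fun _ _ => hy) (fun _ _ => h)

end Ultrametric

variable {F : Type*} [Field F] [Fintype F]

theorem norm_algebraMap_const_le (c : F) : ‖algebraMap F (Cinf F) c‖ ≤ 1 := by
  by_cases hc : c = 0
  · simp [hc]
  · exact (norm_algebraMap_const F c hc).le

open Polynomial in
theorem X_pow_card_sub_X_eq_prod :
    (X ^ Fintype.card F - X : F[X]) = ∏ c : F, (X - C c) := by
  have hq := Fintype.one_lt_card (α := F)
  have hmonic : (X ^ Fintype.card F - X : F[X]).Monic :=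
    monic_X_pow_sub (by rw [degree_X]; exact_mod_cast hq)
  have h := prod_multiset_X_sub_C_of_monic_of_roots_card_eq hmonic (by
    rw [FiniteField.roots_X_pow_card_sub_X, FiniteField.X_pow_card_sub_X_natDegree_eq _ hq]
    rfl)
  rw [FiniteField.roots_X_pow_card_sub_X] at h
  exact h.symm

/-- Since z^q - z = ∏ (z - c) over c in `F`, some factor must be smaller than 1. -/
theorem exists_norm_sub_const_lt_one (z : Cinf F) (hz : ‖z ^ Fintype.card F - z‖ < 1) :
    ∃ c : F, ‖z - algebraMap F (Cinf F) c‖ < 1 := by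
  by_contra! h
  have h1 := congrArg (Polynomial.aeval z) (X_pow_card_sub_X_eq_prod (F := F))
  simp only [map_sub, map_pow, Polynomial.aeval_X, map_prod, Polynomial.aeval_C] at h1
  rw [h1, norm_prod] at hz
  exact hz.not_ge (Finset.one_le_prod fun c _ => h c)

/-! ### Torsion points -/

section Action

variable {R : Type*} [CommRing R] [Algebra F R] [Algebra (Kinf F) R]

theorem carlitz_X_pow_zero (x : R) : carlitz F R (Polynomial.X ^ 0) x = x := by simp [carlitz]

theorem carlitz_X_pow_succ (i : ℕ) (x : R) :
    carlitz F R (Polynomial.X ^ (i + 1)) x =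
      thetaAddTau F R (carlitz F R (Polynomial.X ^ i) x) := by
  rw [pow_succ', map_mul, Module.End.mul_apply]
  simp [carlitz]

theorem carlitz_thetaAddTau (a : Polynomial F) (x : R) :
    carlitz F R a (thetaAddTau F R x) = carlitz F R (a * Polynomial.X) x := by
  simp [carlitz]

theorem carlitz_X_pow_succ' (i : ℕ) (x : R) :
    carlitz F R (Polynomial.X ^ (i + 1)) x =
      carlitz F R (Polynomial.X ^ i) (thetaAddTau F R x) := by
  rw [carlitz_thetaAddTau, pow_succ]

end Action

theorem thetaAddTau_mem_torsion {x : Cinf F} (hx : x ∈ torsion F) :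
    thetaAddTau F (Cinf F) x ∈ torsion F := by
  obtain ⟨a, ha, h0⟩ := hx
  refine ⟨a, ha, ?_⟩
  rw [carlitz_thetaAddTau, mul_comm, map_mul, Module.End.mul_apply, h0, map_zero]

theorem mem_torsion_of_thetaAddTau {x : Cinf F} (hx : thetaAddTau F (Cinf F) x ∈ torsion F) :
    x ∈ torsion F := by
  obtain ⟨a, ha, h0⟩ := hx
  exact ⟨a * Polynomial.X, mul_ne_zero ha Polynomial.X_ne_zero, by rwa [← carlitz_thetaAddTau]⟩

theorem carlitz_X_pow_mem_torsion {x : Cinf F} (hx : x ∈ torsion F) (i : ℕ) :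
    carlitz F (Cinf F) (Polynomial.X ^ i) x ∈ torsion F := by
  induction i with
  | zero => rwa [carlitz_X_pow_zero]
  | succ i ih =>
    rw [carlitz_X_pow_succ]
    exact thetaAddTau_mem_torsion ih

theorem one_lt_of_pow_eq_card {r : ℝ} (hr0 : 0 ≤ r)
    (hr : r ^ (Fintype.card F - 1) = Fintype.card F) : 1 < r := by
  by_contra! h
  have h1 := pow_le_one₀ (n := Fintype.card F - 1) hr0 h
  rw [hr] at h1
  have h2 : (1 : ℝ) < Fintype.card F := by exact_mod_cast Fintype.one_lt_card (α := F)
  linarith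

/-- At |x| = r the terms θx and x^q have the same size; beyond it x^q dominates. -/
theorem norm_thetaAddTau_eq_pow {r : ℝ} (hr0 : 0 ≤ r)
    (hr : r ^ (Fintype.card F - 1) = Fintype.card F) (x : Cinf F) (hx : r < ‖x‖) :
    ‖thetaAddTau F (Cinf F) x‖ = ‖x‖ ^ Fintype.card F := by
  have hq := Fintype.one_lt_card (α := F)
  have h3 : ‖algebraMap (Kinf F) (Cinf F) (Kinf.theta F) * x‖ < ‖x ^ Fintype.card F‖ := by
    rw [norm_mul, norm_pow, norm_theta_Cinf, ← hr]
    calc r ^ (Fintype.card F - 1) * ‖x‖ < ‖x‖ ^ (Fintype.card F - 1) * ‖x‖ :=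
          mul_lt_mul_of_pos_right (pow_lt_pow_left₀ hx hr0 (by omega)) (hr0.trans_lt hx)
      _ = ‖x‖ ^ Fintype.card F := by rw [← pow_succ, Nat.sub_add_cancel hq.le]
  rw [thetaAddTau_apply, IsUltrametricDist.norm_add_eq_max_of_norm_ne_norm h3.ne,
    max_eq_right h3.le, norm_pow]

/-- Torsion points have absolute value at most `q ^ (1 / (q - 1))`. -/
theorem norm_le_of_mem_torsion_of_pow_eq {r : ℝ} (hr0 : 0 ≤ r)
    (hr : r ^ (Fintype.card F - 1) = Fintype.card F) {x : Cinf F} (hx : x ∈ torsion F) :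
    ‖x‖ ≤ r := by
  by_contra! hlt
  have hx1 : 1 < ‖x‖ := (one_lt_of_pow_eq_card hr0 hr).trans hlt
  have hq := Fintype.one_lt_card (α := F)
  -- Outside the disc of radius r the iterates of C_θ grow without bound, whereas they remain
  -- torsion and so have absolute value at most q.
  have key : ∀ n, ‖carlitz F (Cinf F) (Polynomial.X ^ n) x‖ = ‖x‖ ^ Fintype.card F ^ n := by
    intro n
    induction n with
    | zero => rw [carlitz_X_pow_zero, pow_zero, pow_one]
    | succ n ih =>
      have h1 : r < ‖carlitz F (Cinf F) (Polynomial.X ^ n) x‖ := by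
        rw [ih]
        exact hlt.trans_le (le_self_pow₀ hx1.le (by positivity))
      rw [carlitz_X_pow_succ, norm_thetaAddTau_eq_pow hr0 hr _ h1, ih, ← pow_mul, pow_succ]
  obtain ⟨n, hn⟩ := pow_unbounded_of_one_lt (Fintype.card F : ℝ) hx1
  have h2 := norm_le_of_mem_torsion F _ (carlitz_X_pow_mem_torsion hx n)
  rw [key] at h2
  have h3 := pow_le_pow_right₀ hx1.le (Nat.lt_pow_self hq (n := n)).le
  linarith

theorem continuous_carlitz_X_pow (i : ℕ) :
    Continuous fun x : Cinf F => carlitz F (Cinf F) (Polynomial.X ^ i) x := by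
  induction i with
  | zero =>
    simp_rw [carlitz_X_pow_zero]
    exact continuous_id
  | succ i ih =>
    simp_rw [carlitz_X_pow_succ, thetaAddTau_apply]
    exact (continuous_const.mul ih).add (ih.pow _)

theorem norm_carlitz_X_pow_le {r : ℝ} (hr0 : 0 ≤ r)
    (hr : r ^ (Fintype.card F - 1) = Fintype.card F) {x : Cinf F} (hx : x ∈ frakK F) (i : ℕ) :
    ‖carlitz F (Cinf F) (Polynomial.X ^ i) x‖ ≤ r :=
  closure_minimal (s := torsion F)
    (t := {x | ‖carlitz F (Cinf F) (Polynomial.X ^ i) x‖ ≤ r})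
    (fun _ hy => norm_le_of_mem_torsion_of_pow_eq hr0 hr (carlitz_X_pow_mem_torsion hy i))
    (isClosed_le (continuous_carlitz_X_pow i).norm continuous_const) hx

theorem thetaAddTau_const_mul (c : F) (x : Cinf F) :
    thetaAddTau F (Cinf F) (algebraMap F (Cinf F) c * x) =
      algebraMap F (Cinf F) c * thetaAddTau F (Cinf F) x := by
  rw [← Algebra.smul_def, map_smul, Algebra.smul_def]

theorem norm_pow_eq_card {lam : Cinf F}
    (hlam : lam ^ (Fintype.card F - 1) = -algebraMap (Kinf F) (Cinf F) (Kinf.theta F)) :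
    ‖lam‖ ^ (Fintype.card F - 1) = Fintype.card F := by
  rw [← norm_pow, hlam, norm_neg, norm_theta_Cinf]

theorem ne_zero_of_pow_eq {lam : Cinf F}
    (hlam : lam ^ (Fintype.card F - 1) = -algebraMap (Kinf F) (Cinf F) (Kinf.theta F)) :
    lam ≠ 0 := by
  rintro rfl
  have h1 := one_lt_of_pow_eq_card (norm_nonneg _) (norm_pow_eq_card hlam)
  rw [norm_zero] at h1
  linarith

theorem pow_card_eq {lam : Cinf F}
    (hlam : lam ^ (Fintype.card F - 1) = -algebraMap (Kinf F) (Cinf F) (Kinf.theta F)) :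
    lam ^ Fintype.card F =
    -algebraMap (Kinf F) (Cinf F) (Kinf.theta F) * lam := by
  rw [← hlam, ← pow_succ, Nat.sub_add_cancel (Fintype.one_lt_card (α := F)).le]

/-- Scaling by `lam` turns C_θ into a multiple of the Artin–Schreier polynomial, which ties torsion
points to residues in `F`. -/
theorem thetaAddTau_mul {lam : Cinf F}
    (hlam : lam ^ (Fintype.card F - 1) = -algebraMap (Kinf F) (Cinf F) (Kinf.theta F))
    (y : Cinf F) : thetaAddTau F (Cinf F) (lam * y) =
    -algebraMap (Kinf F) (Cinf F) (Kinf.theta F) * lam * (y ^ Fintype.card F - y) := by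
  rw [thetaAddTau_apply, mul_pow, pow_card_eq hlam]
  ring

theorem thetaAddTau_eq_zero {lam : Cinf F}
    (hlam : lam ^ (Fintype.card F - 1) = -algebraMap (Kinf F) (Cinf F) (Kinf.theta F)) :
    thetaAddTau F (Cinf F) lam = 0 := by
  have := thetaAddTau_mul hlam 1
  simpa using this

/-- The root is taken in `AlgKinf F`, where `exists_thetaAddTau_eq` supplies preimages under C_θ. -/
theorem exists_pow_eq_neg_theta : ∃ μ : AlgKinf F,
    algebraMap (AlgKinf F) (Cinf F) μ ^ (Fintype.card F - 1) =
      -algebraMap (Kinf F) (Cinf F) (Kinf.theta F) := by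
  have hq := Fintype.one_lt_card (α := F)
  obtain ⟨z, hz⟩ := IsAlgClosed.exists_pow_nat_eq
    (-algebraMap (Kinf F) (AlgKinf F) (Kinf.theta F)) (n := Fintype.card F - 1) (by omega)
  exact ⟨z, by rw [← map_pow, hz, map_neg,
    ← IsScalarTower.algebraMap_apply (Kinf F) (AlgKinf F) (Cinf F)]⟩

/-- The leading terms of `C_{θ^i}(x)`, for `i < n`, at a torsion point `x` can be prescribed. -/
theorem exists_torsion_carlitz_approx {μ : AlgKinf F} {lam : Cinf F}
    (hμ : algebraMap (AlgKinf F) (Cinf F) μ = lam)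
    (hlam : lam ^ (Fintype.card F - 1) = -algebraMap (Kinf F) (Cinf F) (Kinf.theta F))
    (n : ℕ) (p : ℕ → F) :
    ∃ x : AlgKinf F, algebraMap (AlgKinf F) (Cinf F) x ∈ torsion F ∧ ∀ i < n,
      ‖carlitz F (Cinf F) (Polynomial.X ^ i) (algebraMap (AlgKinf F) (Cinf F) x) -
        algebraMap F (Cinf F) (p i) * lam‖ < ‖lam‖ := by
  induction n generalizing p with
  | zero => exact ⟨0, by rw [map_zero]; exact zero_mem_torsion F, by simp⟩
  | succ n ih =>
    have h0 := ne_zero_of_pow_eq hlam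
    have hpos : 0 < ‖lam‖ := norm_pos_iff.mpr h0
    -- A point realising the shifted string is lifted through C_θ; the lift has the right residues
    -- at all indices i ≥ 1.
    obtain ⟨x, hx, hxp⟩ := ih fun i => p (i + 1)
    obtain ⟨z, hz⟩ := exists_thetaAddTau_eq F x
    set z' := algebraMap (AlgKinf F) (Cinf F) z
    set y := z' / lam with hy
    have hzy : z' = lam * y := by rw [hy, mul_div_cancel₀ _ h0]
    have h1 : ‖y ^ Fintype.card F - y‖ < 1 := by
      have h2 := norm_le_of_mem_torsion_of_pow_eq hpos.le (norm_pow_eq_card hlam) hx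
      rw [← hz, hzy, thetaAddTau_mul hlam, norm_mul, norm_mul, norm_neg, norm_theta_Cinf] at h2
      have hq : (1 : ℝ) < Fintype.card F := by exact_mod_cast Fintype.one_lt_card (α := F)
      by_contra! h3
      nlinarith [mul_lt_mul_of_pos_right hq hpos]
    obtain ⟨c, hc⟩ := exists_norm_sub_const_lt_one y h1
    -- C_θ kills `lam`, so adding `d * lam` corrects the residue at index 0 from `c` to `p 0`
    -- without touching the others.
    let d : F := p 0 - c
    have hd : algebraMap (AlgKinf F) (Cinf F)
        (z + algebraMap (Kinf F) (AlgKinf F) (algebraMap F (Kinf F) d) * μ) =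
        z' + algebraMap F (Cinf F) d * lam := by
      rw [map_add, map_mul, hμ, ← IsScalarTower.algebraMap_apply (Kinf F) (AlgKinf F) (Cinf F),
        ← IsScalarTower.algebraMap_apply F (Kinf F) (Cinf F)]
    have hT : thetaAddTau F (Cinf F) (z' + algebraMap F (Cinf F) d * lam) =
        algebraMap (AlgKinf F) (Cinf F) x := by
      rw [map_add, hz, thetaAddTau_const_mul, thetaAddTau_eq_zero hlam, mul_zero, add_zero]
    refine ⟨z + algebraMap (Kinf F) (AlgKinf F) (algebraMap F (Kinf F) d) * μ, ?_, ?_⟩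
    · rw [hd]
      exact mem_torsion_of_thetaAddTau (by rwa [hT])
    · intro i hi
      rw [hd]
      cases i with
      | zero =>
        have h4 : z' + algebraMap F (Cinf F) d * lam - algebraMap F (Cinf F) (p 0) * lam =
            (y - algebraMap F (Cinf F) c) * lam := by
          rw [hzy, map_sub]
          ring
        rw [carlitz_X_pow_zero, h4, norm_mul]
        exact mul_lt_of_lt_one_left hpos hc
      | succ i =>
        rw [carlitz_X_pow_succ', hT]
        exact hxp i (by omega)

/-! ### The polynomials `H_N` -/

section H

variable {R : Type*} [CommRing R] [Algebra F R] [Algebra (Kinf F) R]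

theorem H_eq_prod_range (x : R) {N n : ℕ} (hn : (Nat.digits (Fintype.card F) N).length ≤ n) :
    H F N x = ∏ i ∈ Finset.range n,
      carlitz F R (Polynomial.X ^ i) x ^ (Nat.digits (Fintype.card F) N).getD i 0 :=
  prod_range_getD _ (fun i d => carlitz F R (Polynomial.X ^ i) x ^ d) (fun _ => pow_zero _) hn

theorem digitSum_eq_sum_range {N n : ℕ} (hn : (Nat.digits (Fintype.card F) N).length ≤ n) :
    digitSum F N = ∑ i ∈ Finset.range n, (Nat.digits (Fintype.card F) N).getD i 0 := by
  rw [digitSum, ← sum_range_getD]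
  exact Finset.sum_subset (Finset.range_subset_range.mpr hn) fun i _ hi =>
    List.getD_eq_default _ _ (by simpa using hi)

/-- Used both to evaluate H_N(X) at points and to move it from one variable to several. -/
theorem map_H {S : Type*} [CommRing S] [Algebra F S] [Algebra (Kinf F) S] (φ : R →+* S)
    (hφ : φ (algebraMap (Kinf F) R (Kinf.theta F)) = algebraMap (Kinf F) S (Kinf.theta F))
    (N : ℕ) (x : R) : φ (H F N x) = H F N (φ x) := by
  have h1 : ∀ i, φ (carlitz F R (Polynomial.X ^ i) x) =
      carlitz F S (Polynomial.X ^ i) (φ x) := by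
    intro i
    induction i with
    | zero => simp only [carlitz_X_pow_zero]
    | succ i ih =>
      rw [carlitz_X_pow_succ, carlitz_X_pow_succ, thetaAddTau_apply, thetaAddTau_apply, map_add,
        map_mul, map_pow φ, hφ, ih]
  rw [H, map_prod, H]
  exact Finset.prod_congr rfl fun i _ => by rw [map_pow φ, h1]

end H

theorem norm_H_le {r : ℝ} (hr0 : 0 ≤ r) (hr : r ^ (Fintype.card F - 1) = Fintype.card F)
    {x : Cinf F} (hx : x ∈ frakK F) (N : ℕ) : ‖H F N x‖ ≤ r ^ digitSum F N := by
  rw [H, norm_prod, digitSum, ← sum_range_getD, ← Finset.prod_pow_eq_pow_sum]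
  refine Finset.prod_le_prod (fun _ _ => norm_nonneg _) fun i _ => ?_
  rw [norm_pow]
  exact pow_le_pow_left₀ (norm_nonneg _) (norm_carlitz_X_pow_le hr0 hr hx i) _

/-- A linear combination of products of `H_N` takes a value at a torsion point which is at least
as large as each term. -/
theorem exists_torsion_le_norm_sum {s : ℕ} {r : ℝ} (hr0 : 0 ≤ r)
    (hr : r ^ (Fintype.card F - 1) = Fintype.card F) (S : Finset (Fin s → ℕ))
    (a : (Fin s → ℕ) → Cinf F) (N₀ : Fin s → ℕ) (hN₀ : N₀ ∈ S) :
    ∃ x : Fin s → Cinf F, (∀ j, x j ∈ torsion F) ∧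
      ‖a N₀‖ * r ^ (∑ j, digitSum F (N₀ j)) ≤ ‖∑ N ∈ S, a N * ∏ j, H F (N j) (x j)‖ := by
  classical
  have hq := Fintype.one_lt_card (α := F)
  obtain ⟨μ, hlam⟩ := exists_pow_eq_neg_theta (F := F)
  obtain ⟨lam, hμ⟩ : ∃ lam, algebraMap (AlgKinf F) (Cinf F) μ = lam := ⟨_, rfl⟩
  rw [hμ] at hlam
  have h0 := ne_zero_of_pow_eq hlam
  obtain rfl : r = ‖lam‖ :=
    (pow_left_inj₀ hr0 (norm_nonneg _) (by omega)).mp (hr.trans (norm_pow_eq_card hlam).symm)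
  let ι := algebraMap F (Cinf F)
  let l : (Fin s → ℕ) → ℕ := fun N => ∑ j, digitSum F (N j)
  -- Coefficients after dividing each H-product by its power of `lam`; their norms are the weighted
  -- norms being compared.
  let b : (Fin s → ℕ) → Cinf F := fun N => a N * lam ^ l N
  have hb : ∀ N, ‖b N‖ = ‖a N‖ * ‖lam‖ ^ l N := fun N => by rw [norm_mul, norm_pow]
  -- It suffices to treat a dominant index. If every torsion value were smaller than the `N₀` term,
  -- all would be strictly smaller than `‖b N₁‖`.
  obtain ⟨N₁, hN₁, hmax⟩ := S.exists_max_image (fun N => ‖b N‖) ⟨N₀, hN₀⟩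
  by_contra! hcon
  have hlt : ∀ x : Fin s → Cinf F, (∀ j, x j ∈ torsion F) →
      ‖∑ N ∈ S, a N * ∏ j, H F (N j) (x j)‖ < ‖b N₁‖ := fun x hx => by
    refine (hcon x hx).trans_le ?_
    rw [← hb]
    exact hmax N₀ hN₀
  have hpos : 0 < ‖b N₁‖ := (norm_nonneg _).trans_lt (hlt (fun _ => 0) fun _ => zero_mem_torsion F)
  obtain ⟨n, hn⟩ : ∃ n, ∀ N ∈ S, ∀ j, (Nat.digits (Fintype.card F) (N j)).length ≤ n :=
    ⟨S.sup fun N => Finset.univ.sup fun j => (Nat.digits (Fintype.card F) (N j)).length,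
      fun N hN j => (Finset.le_sup (f := fun j => (Nat.digits (Fintype.card F) (N j)).length)
        (Finset.mem_univ j)).trans (Finset.le_sup (f := fun N : Fin s → ℕ => Finset.univ.sup
          fun j => (Nat.digits (Fintype.card F) (N j)).length) hN)⟩
  -- Exponents of the reduced monomial in s·n variables: all base-q digits of all components, which
  -- determine `N` within `S`.
  let d : (Fin s → ℕ) → Fin s × Fin n → ℕ := fun N k =>
    (Nat.digits (Fintype.card F) (N k.1)).getD k.2 0
  have hd : ∀ N k, d N k < Fintype.card F := fun N k => digits_getD_lt hq _ _
  have hdinj : ∀ N ∈ S, (d N = d N₁ ↔ N = N₁) := by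
    refine fun N hN => ⟨fun h => ?_, fun h => by rw [h]⟩
    funext j
    exact digits_getD_injOn _ (hn N hN j) (hn N₁ hN₁ j) fun i hi => congrFun h (j, ⟨i, hi⟩)
  have hl : ∀ N ∈ S, l N = ∑ k, d N k := by
    intro N hN
    rw [Fintype.sum_prod_type]
    refine Finset.sum_congr rfl fun j _ => ?_
    rw [digitSum_eq_sum_range (hn N hN j), Finset.sum_range]
  have hH : ∀ (x : Fin s → Cinf F), ∀ N ∈ S, ∏ j, H F (N j) (x j) = lam ^ l N *
      ∏ k, (carlitz F (Cinf F) (Polynomial.X ^ (k.2 : ℕ)) (x k.1) / lam) ^ d N k := by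
    intro x N hN
    rw [hl N hN, ← Finset.prod_pow_eq_pow_sum, ← Finset.prod_mul_distrib, Fintype.prod_prod_type]
    refine Finset.prod_congr rfl fun j _ => ?_
    rw [H_eq_prod_range (x j) (hn N hN j), Finset.prod_range]
    refine Finset.prod_congr rfl fun i _ => ?_
    rw [← mul_pow, mul_div_cancel₀ _ h0]
  obtain ⟨w, hw⟩ := exists_dual_prod_pow F (d N₁)
  -- The assumed smallness at torsion points transfers to the reduced polynomial at every point of
  -- the finite grid: pick a torsion tuple with residues `p`, and the discrepancy is below `‖b N₁‖`.
  have hpt : ∀ p : Fin s × Fin n → F, ‖∑ N ∈ S, b N * ι (∏ k, p k ^ d N k)‖ < ‖b N₁‖ := by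
    intro p
    choose x hx hxp using fun j => exists_torsion_carlitz_approx hμ hlam n
      -- Only indices below `n` matter; the value 0 elsewhere is a filler.
      fun i => if h : i < n then p (j, ⟨i, h⟩) else 0
    let X : Fin s → Cinf F := fun j => algebraMap (AlgKinf F) (Cinf F) (x j)
    let y : Fin s × Fin n → Cinf F := fun k =>
      carlitz F (Cinf F) (Polynomial.X ^ (k.2 : ℕ)) (X k.1) / lam
    have hy : ∀ k, ‖ι (p k) - y k‖ < 1 := by
      intro k
      have h1 := hxp k.1 k.2 k.2.2
      rw [dif_pos k.2.2, ← norm_neg, neg_sub] at h1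
      have h2 : ι (p k) - y k = (ι (p k) * lam -
          carlitz F (Cinf F) (Polynomial.X ^ (k.2 : ℕ)) (X k.1)) / lam := by
        rw [sub_div, mul_div_cancel_right₀ _ h0]
      rw [h2, norm_div, div_lt_one (norm_pos_iff.mpr h0)]
      exact h1
    have hp1 : ∀ k, ‖ι (p k)‖ ≤ 1 := fun k => norm_algebraMap_const_le _
    have hy1 : ∀ k, ‖y k‖ ≤ 1 := fun k => by
      have h2 := IsUltrametricDist.norm_add_le_max (ι (p k)) (-(ι (p k) - y k))
      rw [norm_neg, ← sub_eq_add_neg, sub_sub_cancel] at h2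
      exact h2.trans (max_le (hp1 k) (hy k).le)
    have h3 : ∑ N ∈ S, b N * ι (∏ k, p k ^ d N k) =
        ∑ N ∈ S, a N * ∏ j, H F (N j) (X j) +
          ∑ N ∈ S, b N * (∏ k, ι (p k) ^ d N k - ∏ k, y k ^ d N k) := by
      rw [← Finset.sum_add_distrib]
      refine Finset.sum_congr rfl fun N hN => ?_
      rw [hH X N hN, map_prod]
      simp only [map_pow, b, y]
      ring
    rw [h3]
    refine (IsUltrametricDist.norm_add_le_max _ _).trans_lt (max_lt (hlt X hx) ?_)
    refine norm_sum_lt_of_forall_lt _ _ hpos fun N hN => ?_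
    rw [norm_mul]
    have h4 := norm_prod_sub_prod_lt_one Finset.univ (fun k => ι (p k) ^ d N k)
      (fun k => y k ^ d N k)
      (fun k _ => by rw [norm_pow]; exact pow_le_one₀ (norm_nonneg _) (hp1 k))
      (fun k _ => by rw [norm_pow]; exact pow_le_one₀ (norm_nonneg _) (hy1 k))
      (fun k _ => norm_pow_sub_pow_lt_one _ _ (hp1 k) (hy1 k) (hy k) _)
    have h5 := hmax N hN
    by_cases h6 : ‖b N‖ = 0
    · rwa [h6, zero_mul]
    · exact (mul_lt_of_lt_one_right (lt_of_le_of_ne (norm_nonneg _) (Ne.symm h6)) h4).trans_le h5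
  -- The dual weights recover `b N₁` from grid values that are all smaller than it, a contradiction.
  have hrec : b N₁ = ∑ p, ι (w p) * ∑ N ∈ S, b N * ι (∏ k, p k ^ d N k) := by
    simp_rw [Finset.mul_sum]
    rw [Finset.sum_comm]
    have h7 : ∀ N ∈ S, ∑ p, ι (w p) * (b N * ι (∏ k, p k ^ d N k)) =
        if N = N₁ then b N else 0 := by
      intro N hN
      have h8 := congrArg ι (hw (d N) (hd N))
      rw [map_sum] at h8
      simp_rw [map_mul ι] at h8
      simp_rw [mul_left_comm _ (b N), ← Finset.mul_sum]
      rw [h8, if_congr (hdinj N hN) rfl rfl]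
      split_ifs <;> simp
    rw [Finset.sum_congr rfl h7, Finset.sum_ite_eq' S N₁ b, if_pos hN₁]
  have hfin : ‖b N₁‖ < ‖b N₁‖ := by
    conv_lhs => rw [hrec]
    refine norm_sum_lt_of_forall_lt _ _ hpos fun p _ => ?_
    rw [norm_mul]
    exact (mul_le_of_le_one_left (norm_nonneg _) (norm_algebraMap_const_le _)).trans_lt (hpt p)
  exact lt_irrefl _ hfin

end Carlitz

/-! ### Products of `H_N` in `Poly E s`: orthogonality and span -/

namespace Carlitz

variable {F : Type*} [Field F] [Fintype F]

variable (E : IntermediateField (Kinf F) (Cinf F)) (s : ℕ)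

theorem algebraMap_Poly_Kinf (c : Kinf F) :
    algebraMap (Kinf F) (Poly E s) c = algebraMap E (Poly E s) (algebraMap (Kinf F) E c) := rfl

theorem evalAt_HProd (x : Fin s → Cinf F) (N : Fin s → ℕ) :
    Poly.evalAt E s x (HProd E s N) = ∏ j, H F (N j) (x j) := by
  rw [HProd, map_prod]
  refine Finset.prod_congr rfl fun j _ => ?_
  have hX : Poly.evalAt E s x (Poly.X E s j) = x j := MvPolynomial.aeval_X (R := E) x j
  rw [← hX]
  refine map_H (F := F) (Poly.evalAt E s x : Poly E s →+* Cinf F) ?_ (N j) (Poly.X E s j)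
  rw [algebraMap_Poly_Kinf]
  exact (Poly.evalAt E s x).commutes _

/-- The upper bound holds pointwise on 𝔎^s by the ultrametric inequality; the lower bound is
witnessed at a torsion point, depending on the index. -/
theorem isOrthogonalFamily_HProd {r : ℝ} (hr0 : 0 ≤ r)
    (hr : r ^ (Fintype.card F - 1) = Fintype.card F) :
    IsOrthogonalFamily E (HProd E s) fun N => r ^ (∑ j, digitSum F (N j)) := by
  have heval : ∀ (S : Finset (Fin s → ℕ)) (a : (Fin s → ℕ) → E) (x : Fin s → Cinf F),
      Poly.evalAt E s x (∑ N ∈ S, a N • HProd E s N) =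
        ∑ N ∈ S, (a N : Cinf F) * ∏ j, H F (N j) (x j) := by
    intro S a x
    rw [map_sum]
    refine Finset.sum_congr rfl fun N _ => ?_
    rw [map_smul, evalAt_HProd, Algebra.smul_def]
    rfl
  refine ⟨fun N => pow_pos (by linarith [one_lt_of_pow_eq_card hr0 hr]) _, ?_, ?_⟩
  · intro S a M hM ha
    refine ciSup_le fun x => ?_
    rw [heval]
    refine IsUltrametricDist.norm_sum_le_of_forall_le_of_nonneg hM fun N hN => ?_
    refine le_trans ?_ (ha N hN)
    rw [norm_mul, norm_prod, ← Finset.prod_pow_eq_pow_sum]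
    refine mul_le_mul_of_nonneg_left ?_ (norm_nonneg _)
    exact Finset.prod_le_prod (fun _ _ => norm_nonneg _) fun j _ => norm_H_le hr0 hr (x j).2 _
  · intro S a N hN
    obtain ⟨x, hx, hle⟩ := exists_torsion_le_norm_sum hr0 hr S (fun N => (a N : Cinf F)) N hN
    refine hle.trans ?_
    rw [← heval]
    exact Poly.norm_evalAt_le E s _ fun j => ⟨x j, subset_closure (hx j)⟩

open Polynomial in
theorem carlitz_X_monic (K : Type*) [Field K] [Algebra F K] [Algebra (Kinf F) K] (i : ℕ) :
    (carlitz F K[X] (X ^ i) (X : K[X])).Monic ∧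
      (carlitz F K[X] (X ^ i) (X : K[X])).natDegree = Fintype.card F ^ i := by
  have hq := Fintype.one_lt_card (α := F)
  induction i with
  | zero =>
    rw [carlitz_X_pow_zero]
    simp [monic_X]
  | succ i ih =>
    rw [carlitz_X_pow_succ, thetaAddTau_apply]
    set Q := carlitz F K[X] (X ^ i) (X : K[X])
    have hpow := ih.1.pow (Fintype.card F)
    have hdeg : (Q ^ Fintype.card F).natDegree = Fintype.card F ^ (i + 1) := by
      rw [ih.1.natDegree_pow, ih.2, pow_succ']
    have hlt : (algebraMap (Kinf F) K[X] (Kinf.theta F) * Q).degree <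
        (Q ^ Fintype.card F).degree := by
      refine degree_lt_degree ?_
      rw [hdeg, Polynomial.algebraMap_apply]
      refine (natDegree_C_mul_le _ _).trans_lt ?_
      rw [ih.2]
      exact Nat.pow_lt_pow_right hq (Nat.lt_succ_self i)
    exact ⟨hpow.add_of_right hlt, by rw [natDegree_add_eq_right_of_degree_lt hlt, hdeg]⟩

-- C_{θ^i}(X) has degree q^i, so the degree of H_N is ∑ N_i q^i = N.
open Polynomial in
theorem H_X_monic (K : Type*) [Field K] [Algebra F K] [Algebra (Kinf F) K] (N : ℕ) :
    (H F N (X : K[X])).Monic ∧ (H F N (X : K[X])).natDegree = N := by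
  have h := carlitz_X_monic (F := F) K
  refine ⟨monic_prod_of_monic _ _ fun i _ => (h i).1.pow _, ?_⟩
  rw [H, natDegree_prod_of_monic _ _ fun i _ => (h i).1.pow _]
  simp_rw [(h _).1.natDegree_pow, (h _).2]
  rw [sum_range_getD_mul_pow, Nat.ofDigits_digits]

open Polynomial in
theorem span_H_X (K : Type*) [Field K] [Algebra F K] [Algebra (Kinf F) K] :
    Submodule.span K (Set.range fun N => H F N (X : K[X])) = ⊤ := by
  have h := H_X_monic (F := F) K
  let S : Polynomial.Sequence K :=
    ⟨fun N => H F N (X : K[X]), fun N => by rw [degree_eq_natDegree (h N).1.ne_zero, (h N).2]⟩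
  exact S.span fun N => by
    rw [show S N = H F N (X : K[X]) from rfl, (h N).1.leadingCoeff]
    exact isUnit_one

theorem prod_mem_prod_submodule {K A ι : Type*} [CommSemiring K] [CommSemiring A] [Algebra K A]
    (S : Finset ι) (M : ι → Submodule K A) (x : ι → A) (h : ∀ i ∈ S, x i ∈ M i) :
    ∏ i ∈ S, x i ∈ ∏ i ∈ S, M i := by
  classical
  induction S using Finset.induction_on with
  | empty => exact Submodule.one_le.mp le_rfl
  | insert i S hi ih =>
    simp only [Finset.mem_insert, forall_eq_or_imp] at h
    rw [Finset.prod_insert hi, Finset.prod_insert hi]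
    exact Submodule.mul_mem_mul h.1 (ih h.2)

theorem span_HProd : ⊤ ≤ Submodule.span E (Set.range (HProd E s)) := by
  let φ : Fin s → Polynomial E →ₐ[E] Poly E s := fun j => Polynomial.aeval (Poly.X E s j)
  have hφ : ∀ j N, φ j (H F N (Polynomial.X : Polynomial E)) = H F N (Poly.X E s j) := by
    intro j N
    refine (map_H (φ j : Polynomial E →+* Poly E s) ?_ _ _).trans ?_
    · rw [algebraMap_Poly_Kinf, Polynomial.algebraMap_apply]
      exact Polynomial.aeval_C _ _
    · congr 1
      exact Polynomial.aeval_X _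
  have hpow : ∀ j n, Poly.X E s j ^ n ∈
      Submodule.span E (Set.range fun N => H F N (Poly.X E s j)) := by
    intro j n
    have h1 : (Polynomial.X ^ n : Polynomial E) ∈
        Submodule.span E (Set.range fun N => H F N (Polynomial.X : Polynomial E)) := by
      rw [span_H_X]
      trivial
    have h2 := Submodule.mem_map_of_mem (f := (φ j).toLinearMap) h1
    rw [Submodule.map_span, ← Set.range_comp] at h2
    simp only [AlgHom.toLinearMap_apply, map_pow, φ, Polynomial.aeval_X] at h2
    convert! h2 using 3
    funext N
    exact (hφ j N).symm
  have hmon : ∀ n : Fin s → ℕ, ∏ j, Poly.X E s j ^ n j ∈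
      Submodule.span E (Set.range (HProd E s)) := by
    intro n
    have h3 : ∏ j, Poly.X E s j ^ n j ∈
        ∏ j, Submodule.span E (Set.range fun N => H F N (Poly.X E s j)) :=
      prod_mem_prod_submodule _ _ _ fun j _ => hpow j (n j)
    -- A product of spans is the span of the products, which reduces several variables to one.
    rw [Submodule.prod_span] at h3
    refine Submodule.span_mono ?_ h3
    intro Q hQ
    obtain ⟨g, hg, rfl⟩ := (Set.mem_fintype_prod _ _).mp hQ
    choose N hN using hg
    exact ⟨N, Finset.prod_congr rfl fun j _ => hN j⟩
  intro P _
  induction P using MvPolynomial.induction_on' with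
  | monomial u a =>
    have h4 : (MvPolynomial.monomial u a : MvPolynomial (Fin s) E) =
        (a • ∏ j, Poly.X E s j ^ u j : Poly E s) := by
      rw [MvPolynomial.monomial_eq, Finsupp.prod_fintype _ _ fun _ => pow_zero _]
      exact (MvPolynomial.smul_eq_C_mul _ a).symm
    rw [h4]
    exact Submodule.smul_mem _ _ (hmon _)
  | add p q hp hq => exact Submodule.add_mem _ (hp trivial) (hq trivial)

/-! ### The absolute value of the period -/

theorem norm_theta_pow_sub {n : ℕ} (hn : 1 < n) :
    ‖algebraMap (Kinf F) (Cinf F) (Kinf.theta F) ^ n -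
      algebraMap (Kinf F) (Cinf F) (Kinf.theta F)‖ = (Fintype.card F : ℝ) ^ n := by
  have hq : (1 : ℝ) < Fintype.card F := by exact_mod_cast Fintype.one_lt_card (α := F)
  have h1 : ‖-algebraMap (Kinf F) (Cinf F) (Kinf.theta F)‖ <
      ‖algebraMap (Kinf F) (Cinf F) (Kinf.theta F) ^ n‖ := by
    rw [norm_neg, norm_pow, norm_theta_Cinf]
    exact lt_self_pow₀ hq hn
  rw [sub_eq_add_neg, IsUltrametricDist.norm_add_eq_max_of_norm_ne_norm h1.ne', max_eq_left h1.le,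
    norm_pow, norm_theta_Cinf]

/-- Each factor is 1 minus an element of absolute value less than 1, hence has absolute value 1, and
the norm passes to the infinite product. -/
theorem norm_period (ρ : Cinf F) : ‖period ρ‖ = ‖ρ‖ := by
  have hq := Fintype.one_lt_card (α := F)
  have hqR : (1 : ℝ) < Fintype.card F := by exact_mod_cast hq
  have h1 := (multipliable_period F).hasProd.norm
  have h2 : ∀ i : ℕ, ‖1 - (algebraMap (Kinf F) (Cinf F) (Kinf.theta F) ^ Fintype.card F ^ (i + 1) -
        algebraMap (Kinf F) (Cinf F) (Kinf.theta F)) /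
      (algebraMap (Kinf F) (Cinf F) (Kinf.theta F) ^ Fintype.card F ^ (i + 2) -
        algebraMap (Kinf F) (Cinf F) (Kinf.theta F))‖ = 1 := by
    intro i
    have h3 : ‖-((algebraMap (Kinf F) (Cinf F) (Kinf.theta F) ^ Fintype.card F ^ (i + 1) -
        algebraMap (Kinf F) (Cinf F) (Kinf.theta F)) /
      (algebraMap (Kinf F) (Cinf F) (Kinf.theta F) ^ Fintype.card F ^ (i + 2) -
        algebraMap (Kinf F) (Cinf F) (Kinf.theta F)))‖ < ‖(1 : Cinf F)‖ := by
      rw [norm_neg, norm_div, norm_theta_pow_sub (Nat.one_lt_pow (by omega) hq),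
        norm_theta_pow_sub (Nat.one_lt_pow (by omega) hq), norm_one,
        div_lt_one (by positivity)]
      exact pow_lt_pow_right₀ hqR (Nat.pow_lt_pow_right hq (by omega))
    rw [sub_eq_add_neg, IsUltrametricDist.norm_add_eq_max_of_norm_ne_norm h3.ne',
      max_eq_left h3.le, norm_one]
  simp_rw [h2] at h1
  rw [period, norm_mul, h1.unique hasProd_one, mul_one]

theorem norm_pow_period {ρ : Cinf F} (hρ : ρ ^ (Fintype.card F - 1) =
    algebraMap (Kinf F) (Cinf F) (Kinf.theta F - Kinf.theta F ^ Fintype.card F)) :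
    ‖period ρ‖ ^ (Fintype.card F - 1) = (Fintype.card F : ℝ) ^ Fintype.card F := by
  rw [norm_period, ← norm_pow, hρ, map_sub, map_pow, norm_sub_rev,
    norm_theta_pow_sub (Fintype.one_lt_card (α := F))]

/-- |π̃|^{q-1} = q^q gives |π|^{q-1} = 1/q, so π^{l} exactly cancels the weight r^{l}. Comparing
(q-1)-st powers avoids real exponents. -/
theorem norm_uniformizer_mul {r : ℝ} (hr0 : 0 ≤ r)
    (hr : r ^ (Fintype.card F - 1) = Fintype.card F) {ρ : Cinf F}
    (hρ : ρ ^ (Fintype.card F - 1) =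
      algebraMap (Kinf F) (Cinf F) (Kinf.theta F - Kinf.theta F ^ Fintype.card F))
    (hL : fieldL ρ ≤ E) : ‖uniformizer E ρ hL‖ * r = 1 := by
  have hq := Fintype.one_lt_card (α := F)
  have h1 : ‖uniformizer E ρ hL‖ = Fintype.card F / ‖period ρ‖ := by
    rw [← norm_theta_Cinf F, ← norm_div]
    rfl
  have hq0 : (Fintype.card F : ℝ) ≠ 0 := by positivity
  have h2 : (‖uniformizer E ρ hL‖ * r) ^ (Fintype.card F - 1) = 1 := by
    rw [mul_pow, hr, h1, div_pow, norm_pow_period hρ, div_mul_eq_mul_div, ← pow_succ,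
      Nat.sub_add_cancel hq.le, div_self (pow_ne_zero _ hq0)]
  exact (pow_eq_one_iff_of_nonneg (mul_nonneg (norm_nonneg _) hr0) (by omega)).mp h2

theorem GProd_eq_smul (ρ : Cinf F) (hL : fieldL ρ ≤ E) (N : Fin s → ℕ) :
    GProd E s ρ hL N = uniformizer E ρ hL ^ (∑ j, digitSum F (N j)) • HProd E s N := by
  simp only [GProd, G, HProd]
  rw [Finset.prod_mul_distrib, Finset.prod_pow_eq_pow_sum, Algebra.smul_def, map_pow]

theorem isOrthogonalFamily_GProd {ρ : Cinf F} (hρ : ρ ^ (Fintype.card F - 1) =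
    algebraMap (Kinf F) (Cinf F) (Kinf.theta F - Kinf.theta F ^ Fintype.card F))
    (hL : fieldL ρ ≤ E) : IsOrthogonalFamily E (GProd E s ρ hL) fun _ => 1 := by
  obtain ⟨μ, hμ⟩ := exists_pow_eq_neg_theta (F := F)
  have hr := norm_pow_eq_card hμ
  have h1 := norm_uniformizer_mul E (norm_nonneg _) hr hρ hL
  have h2 : uniformizer E ρ hL ≠ 0 := by
    rintro h
    rw [h, norm_zero, zero_mul] at h1
    exact zero_ne_one h1
  have h3 := (isOrthogonalFamily_HProd E s (norm_nonneg _) hr).smul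
    (fun N => uniformizer E ρ hL ^ (∑ j, digitSum F (N j))) fun N => pow_ne_zero _ h2
  convert! h3 using 1
  · funext N
    exact GProd_eq_smul E s ρ hL N
  · funext N
    rw [norm_pow, ← mul_pow, h1, one_pow]

theorem span_GProd {ρ : Cinf F} (hρ : ρ ^ (Fintype.card F - 1) =
    algebraMap (Kinf F) (Cinf F) (Kinf.theta F - Kinf.theta F ^ Fintype.card F))
    (hL : fieldL ρ ≤ E) : ⊤ ≤ Submodule.span E (Set.range (GProd E s ρ hL)) := by
  obtain ⟨μ, hμ⟩ := exists_pow_eq_neg_theta (F := F)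
  have h1 := norm_uniformizer_mul E (norm_nonneg _) (norm_pow_eq_card hμ) hρ hL
  have h2 : uniformizer E ρ hL ≠ 0 := by
    rintro h
    rw [h, norm_zero, zero_mul] at h1
    exact zero_ne_one h1
  refine (span_HProd E s).trans (Submodule.span_le.mpr ?_)
  rintro _ ⟨N, rfl⟩
  have h3 : HProd E s N =
      (uniformizer E ρ hL ^ (∑ j, digitSum F (N j)))⁻¹ • GProd E s ρ hL N := by
    rw [GProd_eq_smul, inv_smul_smul₀ (pow_ne_zero _ h2)]
  rw [h3]
  exact Submodule.smul_mem _ _ (Submodule.subset_span ⟨N, rfl⟩)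

theorem exists_pow_eq_rpow : ∃ r : ℝ, 0 ≤ r ∧ r ^ (Fintype.card F - 1) = Fintype.card F ∧
    ∀ l : ℕ, r ^ l = (Fintype.card F : ℝ) ^ ((l : ℝ) / ((Fintype.card F : ℝ) - 1)) := by
  have hq := Fintype.one_lt_card (α := F)
  have hqR : (1 : ℝ) < Fintype.card F := by exact_mod_cast hq
  have h1 : ∀ l : ℕ, ((Fintype.card F : ℝ) ^ (((Fintype.card F : ℝ) - 1)⁻¹)) ^ l =
      (Fintype.card F : ℝ) ^ ((l : ℝ) / ((Fintype.card F : ℝ) - 1)) := by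
    intro l
    rw [← Real.rpow_natCast, ← Real.rpow_mul (by positivity), inv_mul_eq_div]
  refine ⟨(Fintype.card F : ℝ) ^ (((Fintype.card F : ℝ) - 1)⁻¹), by positivity, ?_, h1⟩
  rw [h1, Nat.cast_sub hq.le, Nat.cast_one, div_self (by linarith), Real.rpow_one]

end Carlitz

/-! ### The orthonormal and orthogonal bases of 𝔹_s(E) -/

theorem mainTheorem4 (F : Type*) [Field F] [Fintype F] (s : ℕ) (hs : 1 ≤ s) :
    -- the orthonormal basis of products of `G_N`, over every complete `E` with `L ⊆ E ⊆ ℂ_∞`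
    (∀ ρ : Carlitz.Cinf F,
      ρ ^ (Fintype.card F - 1) =
        algebraMap (Carlitz.Kinf F) (Carlitz.Cinf F)
          (Carlitz.Kinf.theta F - Carlitz.Kinf.theta F ^ Fintype.card F) →
      ∀ (E : IntermediateField (Carlitz.Kinf F) (Carlitz.Cinf F)) (hL : Carlitz.fieldL ρ ≤ E),
        IsComplete (E : Set (Carlitz.Cinf F)) →
        ∀ P : Carlitz.Banach E s,
          (∃! f : (Fin s → ℕ) → E,
            HasSum (fun N => f N • (Carlitz.GProd E s ρ hL N : Carlitz.Banach E s)) P) ∧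
          ∀ f : (Fin s → ℕ) → E,
            HasSum (fun N => f N • (Carlitz.GProd E s ρ hL N : Carlitz.Banach E s)) P →
              Tendsto f cofinite (𝓝 0) ∧
              IsGreatest (Set.range fun N => ‖f N‖) ‖P‖) ∧
    -- the orthogonal basis of products of `H_N`, over every complete `E` with `K_∞ ⊆ E ⊆ ℂ_∞`
    (∀ E : IntermediateField (Carlitz.Kinf F) (Carlitz.Cinf F),
      IsComplete (E : Set (Carlitz.Cinf F)) →
      ∀ P : Carlitz.Banach E s,
        (∃! f : (Fin s → ℕ) → E,
          HasSum (fun N => f N • (Carlitz.HProd E s N : Carlitz.Banach E s)) P) ∧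
        ∀ f : (Fin s → ℕ) → E,
          HasSum (fun N => f N • (Carlitz.HProd E s N : Carlitz.Banach E s)) P →
            Tendsto (fun N => ‖f N‖ * (Fintype.card F : ℝ) ^
              (((∑ j, Carlitz.digitSum F (N j) : ℕ) : ℝ) / ((Fintype.card F : ℝ) - 1)))
              cofinite (𝓝 0) ∧
            IsGreatest (Set.range fun N =>
              ‖f N • (Carlitz.HProd E s N : Carlitz.Banach E s)‖) ‖P‖ ∧
            IsGreatest (Set.range fun N => ‖f N‖ * (Fintype.card F : ℝ) ^
              (((∑ j, Carlitz.digitSum F (N j) : ℕ) : ℝ) / ((Fintype.card F : ℝ) - 1))) ‖P‖) := by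
  constructor
  · intro ρ hρ E hL hE P
    have : CompleteSpace E := hE.completeSpace_coe
    obtain ⟨h1, h2⟩ := (Carlitz.isOrthogonalFamily_GProd E s hρ hL).completion
      (Carlitz.span_GProd E s hρ hL) P
    refine ⟨h1, fun f hf => ?_⟩
    have h3 := h2 f hf
    simp only [mul_one] at h3
    exact ⟨tendsto_zero_iff_norm_tendsto_zero.mpr h3.1, h3.2⟩
  · intro E hE P
    have : CompleteSpace E := hE.completeSpace_coe
    obtain ⟨r, hr0, hr, hrl⟩ := Carlitz.exists_pow_eq_rpow (F := F)
    have h := Carlitz.isOrthogonalFamily_HProd E s hr0 hr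
    obtain ⟨h1, h2⟩ := h.completion (Carlitz.span_HProd E s) P
    refine ⟨h1, fun f hf => ?_⟩
    have h3 := h2 f hf
    refine ⟨?_, ?_, ?_⟩
    · simpa only [hrl] using h3.1
    · simpa only [norm_smul, UniformSpace.Completion.norm_coe, h.norm_eq] using h3.2
    · simpa only [hrl] using h3.2
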